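/- Let $\mathbb{K}$ be a field with algebraic closure $\overline{\mathbb{K}}$, let $k,d\ge 1$, let $M$ be the set of exponents of the monomials of degree $d$ in $x_0,\dots,x_k$, ordered lexicographically, and $n+1=|M|=\binom{k+d}{d}$. Let $X\subset\mathbb{P}^n$ be the image of the $d$-uple Veronese embedding $\nu:\mathbb{P}^k\to\mathbb{P}^n$, $\nu(x)=(x^m)_{m\in M}$. The Grassmannian $\mathbf{Gr}$ of linear subspaces of codimension $k+1$ in $\mathbb{P}^n$ is embedded by Plücker coordinates: a subspace $N$, cut out by $k+1$ linear forms $\sum_{m\in M} a_{i,m}y_m$ $(0\le i\le k)$, has as coordinates $[m_0\cdots m_k]$, for $m_0<\dots<m_k$ in $M$, the maximal minors $\det(a_{i,m_j})_{i,j}$. The Chow divisor $D_X\subseteq\mathbf{Gr}$ is the set of those $N\in \mathbf{Gr}(\overline{\mathbb{K}})$ that meet $X(\overline{\mathbb{K}})$. A Chow form of $X$ is a homogeneous polynomial $F$ over $\mathbb{K}$ in the Plücker coordinates that vanishes at $N\in\mathbf{Gr}(\overline{\mathbb{K}})$ if and only if $N\in D_X$, and that generates, modulo the ideal of $\mathbf{Gr}$,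 the ideal of all polynomials over $\mathbb{K}$ in the Plücker coordinates that vanish on the affine cone over $D_X$ (the origin included). A resultant of $k+1$ forms of degree $d$ in $k+1$ variables is an irreducible polynomial $R$ over $\mathbb{K}$ in the coefficients $a_{i,m}$ of the $k+1$ forms $f_i=\sum_{m\in M}a_{i,m}x^m$ $(0\le i\le k)$ such that, for all values of the coefficients in $\overline{\mathbb{K}}$, $R(f_0,\dots,f_k)=0$ if and only if $f_0=\dots=f_k=0$ has a solution $x\in\overline{\mathbb{K}}^{k+1}\setminus\{0\}$. Then the Chow form of $X$ is the resultant of $k+1$ forms of degree $d$ in $k+1$ variables. Precisely: a Chow form of $X$ exists; and if $F$ is any Chow form of $X$, then the resultants are exactly the polynomials $c\cdot F\big([m_0\cdots m_k]=\det(a_{i,m_j})_{i,j}\big)$ with $c\in\mathbb{K}\setminus\{0\}$. -/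

import Mathlib

open scoped LinearAlgebra.Projectivization

noncomputable section

/-! ### The Grassmannian in Plücker coordinates -/

namespace Chow

/-- The vector of maximal minors of an `r × ι` matrix: the minor on the columns
`I 0 < I 1 < ⋯ < I (r - 1)`. -/
def pluckerVector {L : Type*} [CommRing L] {ι : Type*} [LinearOrder ι] {r : ℕ}
    (A : Matrix (Fin r) ι L) : (Fin r ↪o ι) → L :=
  fun I => (A.submatrix id I).det

/-- The affine cone, in the space of Plücker coordinates, over a set `S` of linear subspaces of
codimension `r` of `ℙ(L^ι)`: the origin, and all vectors of maximal minors of matrices `A` whose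
`r` rows are equations of some member `N` of `S`. (`Module.Grassmannian L V r` consists of the
subspaces of `V` with quotient of dimension `r`.) -/
def pluckerCone {L : Type*} [Field L] {ι : Type*} [Fintype ι] [LinearOrder ι] {r : ℕ}
    (S : Set (Module.Grassmannian L (ι → L) r)) : Set ((Fin r ↪o ι) → L) :=
  {p | p = 0 ∨ ∃ N ∈ S, ∃ A : Matrix (Fin r) ι L,
    LinearMap.ker A.mulVecLin = N.toSubmodule ∧ p = pluckerVector A}

/-! ### Chow divisor and Chow form -/

/-- The incidence correspondence `{(x, N) | x ∈ N}`. -/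
def incidence (L : Type*) [Field L] (ι : Type*) [Fintype ι] (r : ℕ) :
    Set (ℙ L (ι → L) × Module.Grassmannian L (ι → L) r) :=
  {q | q.1.submodule ≤ q.2.toSubmodule}

/-- The Chow divisor `π₂ (π₁⁻¹ X)`: the linear subspaces of codimension `r` that meet `X`.
It is used for `r = dim X + 1`. -/
def chowDivisor {L : Type*} [Field L] {ι : Type*} [Fintype ι] (r : ℕ)
    (X : Set (ℙ L (ι → L))) : Set (Module.Grassmannian L (ι → L) r) :=
  Prod.snd '' (incidence L ι r ∩ Prod.fst ⁻¹' X)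

/-- `F` is a Chow form, with coefficients in `K` and in Plücker coordinates, of a projective
variety of dimension `r - 1` whose set of geometric points is `X`: it is homogeneous, it vanishes
at a point of the Grassmannian exactly when this point lies on the Chow divisor, and it generates
the ideal of the Chow divisor modulo the ideal of the Grassmannian. -/
structure IsChowForm (K : Type*) [Field K] {ι : Type*} [Fintype ι] [LinearOrder ι] (r : ℕ)
    (X : Set (ℙ (AlgebraicClosure K) (ι → AlgebraicClosure K)))
    (F : MvPolynomial (Fin r ↪o ι) K) : Prop where
  homogeneous : ∃ m : ℕ, F.IsHomogeneous m
  vanishes_iff : ∀ (N : Module.Grassmannian (AlgebraicClosure K) (ι → AlgebraicClosure K) r)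
    (A : Matrix (Fin r) ι (AlgebraicClosure K)), LinearMap.ker A.mulVecLin = N.toSubmodule →
      (MvPolynomial.aeval (pluckerVector A) F = 0 ↔ N ∈ chowDivisor r X)
  generates : MvPolynomial.vanishingIdeal K (pluckerCone (chowDivisor r X)) =
    Ideal.span {F} ⊔ MvPolynomial.vanishingIdeal K
      (pluckerCone (Set.univ :
        Set (Module.Grassmannian (AlgebraicClosure K) (ι → AlgebraicClosure K) r)))

/-- Substitute for each Plücker coordinate the corresponding maximal minor of the generic
`r × ι` matrix, whose entry in row `i` and column `j` is the variable `(i, j)`. -/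
def substMinors {K : Type*} [Field K] {ι : Type*} [LinearOrder ι] {r : ℕ}
    (F : MvPolynomial (Fin r ↪o ι) K) : MvPolynomial (Fin r × ι) K :=
  MvPolynomial.aeval (pluckerVector (Matrix.of fun i j => MvPolynomial.X (i, j))) F

/-! ### Forms, the resultant and the Veronese embedding -/

/-- Exponents of the monomials of degree `d` in the variables `x₀, …, x_k`. -/
def Mon (k d : ℕ) : Type := {m : Fin (k + 1) →₀ ℕ // m.degree = d}

/-- The order `x₀ᵈ < x₀ᵈ⁻¹ x₁ < ⋯ < x_kᵈ` of the monomials (decreasing lexicographic). -/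
instance (k d : ℕ) : LinearOrder (Mon k d) :=
  LinearOrder.lift' (fun m : Mon k d => OrderDual.toDual (toLex m.1))
    (fun _ _ h => Subtype.ext (toLex.injective (OrderDual.toDual.injective h)))

instance (k d : ℕ) : Finite (Mon k d) := by
  have : Finite {m : Fin (k + 1) →₀ ℕ | m.degree = d} := by
    refine Set.Finite.subset (Finset.finite_toSet
      (Finset.finsuppAntidiag (Finset.univ : Finset (Fin (k + 1))) d)) ?_
    intro m hm
    have hm' : m.degree = d := hm
    simp [Finset.mem_finsuppAntidiag, ← hm', Finsupp.degree_eq_sum]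
  exact this

instance (k d : ℕ) : Fintype (Mon k d) := Fintype.ofFinite _

/-- The form of degree `d` in `k + 1` variables with coefficients `c`. -/
def form {L : Type*} [CommRing L] {k d : ℕ} (c : Mon k d → L) : MvPolynomial (Fin (k + 1)) L :=
  ∑ m : Mon k d, MvPolynomial.monomial m.1 (c m)

/-- `R` is a resultant over `K` of `k + 1` forms of degree `d` in `k + 1` variables: an
irreducible polynomial in the coefficients of the forms that vanishes at a system of forms (with
coefficients in the algebraic closure) exactly when the system has a non-trivial common zero. -/
structure IsResultant (K : Type*) [Field K] (k d : ℕ)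
    (R : MvPolynomial (Fin (k + 1) × Mon k d) K) : Prop where
  irreducible : Irreducible R
  vanishes_iff : ∀ c : Fin (k + 1) → Mon k d → AlgebraicClosure K,
    MvPolynomial.aeval (fun q : Fin (k + 1) × Mon k d => c q.1 q.2) R = 0 ↔
      ∃ x : Fin (k + 1) → AlgebraicClosure K, x ≠ 0 ∧
        ∀ i, MvPolynomial.eval x (form (c i)) = 0

/-- The vector of all monomials of degree `d` in the coordinates of `x`. -/
def monomials {L : Type*} [CommRing L] (k d : ℕ) (x : Fin (k + 1) → L) : Mon k d → L :=
  fun m => ∏ i, x i ^ m.1 i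

theorem monomials_ne_zero {L : Type*} [Field L] (k d : ℕ) {x : Fin (k + 1) → L} (hx : x ≠ 0) :
    monomials k d x ≠ 0 := by
  obtain ⟨i, hi⟩ := Function.ne_iff.1 hx
  intro h
  have h1 : ∏ j, x j ^ (Finsupp.single i d) j = 0 :=
    congrFun h ⟨Finsupp.single i d, Finsupp.degree_single i d⟩
  obtain ⟨j, -, hj⟩ := Finset.prod_eq_zero_iff.1 h1
  by_cases hij : i = j
  · subst hij
    exact pow_ne_zero _ hi hj
  · simp [hij] at hj

theorem monomials_smul {L : Type*} [Field L] (k d : ℕ) (t : L) (x : Fin (k + 1) → L) :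
    monomials k d (t • x) = t ^ d • monomials k d x := by
  funext m
  have h : ∑ i, m.1 i = d := by rw [← Finsupp.degree_eq_sum]; exact m.2
  simp only [monomials, Pi.smul_apply, smul_eq_mul, mul_pow, Finset.prod_mul_distrib,
    Finset.prod_pow_eq_pow_sum, h]

/-- The `d`-uple Veronese map `ℙᵏ → ℙⁿ`, `n + 1 = #(Mon k d)`, on `L`-points. -/
def veronese (L : Type*) [Field L] (k d : ℕ) :
    ℙ L (Fin (k + 1) → L) → ℙ L (Mon k d → L) :=
  Projectivization.lift
    (fun x => Projectivization.mk L (monomials k d x.1) (monomials_ne_zero k d x.2))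
    (by
      rintro ⟨a, ha⟩ ⟨b, hb⟩ t h
      refine (Projectivization.mk_eq_mk_iff' L _ _ _ _).2 ⟨t ^ d, ?_⟩
      exact (monomials_smul k d t b).symm.trans (congrArg (monomials k d) h.symm))

end Chow

end

open scoped LinearAlgebra.Projectivization

noncomputable section

namespace Chow
open MvPolynomial

/-! If `N` is the kernel of `A`, then `ν(x) ∈ N` says that the `k + 1` forms with coefficient rows
`A` vanish at `x`. Resultant and Chow form are therefore both governed by the ideal `V` of
`solvableSystems` over the algebraic closure.

`V` is principal with a prime generator `R` (`exists_prime_span_eq_vanishingIdeal`). It is prime as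
the kernel of substituting a generic system that vanishes at a generic point, and nonzero because
minors of Macaulay matrices give eliminants (`exists_eliminant`). In such a generic system all
coefficients but one are algebraically independent, as their leading exponents show; so every
nonzero element of `V` involves that coefficient, which forces a prime of this kind to be principal.
Eliminants also show that `R` vanishes only at solvable systems, so the resultants are the
associates of `R`.

`R` is a polynomial in the brackets. Row operations preserve solvability, hence `R` is invariant
under adding multiples of rows to other rows and homogeneous of one common degree in all rows. The
first fundamental theorem (`exists_substMinors_eq`) applies. Its proof is free of characteristic: in
a term order where each minor is led by its diagonal, the leading exponent of an invariant satisfies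
ballot inequalities (`RowShiftInvariant.sum_le_sum`), that is, it comes from a semistandard tableau;
a product of minors has the same leading exponent and can be subtracted.

The kernel of `substMinors` is the ideal of the Grassmannian. If `G` vanishes on the cone over the
Chow divisor, then `R` divides `substMinors G`, and the quotient is again a bracket polynomial by
the fundamental theorem. So a bracket expression `F` of `R` generates modulo the Grassmannian ideal.
Any two such generators have associated images under `substMinors`. -/

/-! ### Polynomials in the entries of a matrix that are invariant under row operations -/

section RowShift

variable {K : Type*} [Field K] {ρ ι : Type*}

/-- The polynomial `f` in the entries of a `ρ × ι` matrix is homogeneous of degree `D` in the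
entries of the row `s`. -/
def RowHomogeneous [Fintype ι] (s : ρ) (f : MvPolynomial (ρ × ι) K) (D : ℕ) : Prop :=
  ∀ μ ∈ f.support, ∑ m, μ (s, m) = D

/-- The entries of the generic `ρ × ι` matrix, as constant polynomials in one more variable. -/
abbrev constEntry (K : Type*) [Field K] (ρ ι : Type*) :
    ρ × ι → Polynomial (MvPolynomial (ρ × ι) K) :=
  fun q => Polynomial.C (X q)

/-- Add `t` times row `i` to row `j`. -/
def rowShift [DecidableEq ρ] {B : Type*} [CommRing B] (i j : ρ) (t : B) (z : ρ × ι → B) :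
    ρ × ι → B :=
  fun q => z q + if q.1 = j then t * z (i, q.2) else 0

/-- The polynomial `f` is invariant under adding multiples of row `i` to row `j`. -/
def RowShiftInvariant [DecidableEq ρ] (i j : ρ) (f : MvPolynomial (ρ × ι) K) : Prop :=
  aeval (rowShift i j Polynomial.X (constEntry K ρ ι)) f =
    (Polynomial.C f : Polynomial (MvPolynomial (ρ × ι) K))

/-- The shift by an indeterminate specializes to every shift. Stating invariance with an
indeterminate keeps it meaningful over finite fields. -/
theorem aeval_rowShift_eq_eval₂ [DecidableEq ρ] {B : Type*} [CommRing B] [Algebra K B] {i j : ρ}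
    (f : MvPolynomial (ρ × ι) K) (z : ρ × ι → B) (t : B) :
    aeval (rowShift i j t z) f = Polynomial.eval₂ (aeval z : MvPolynomial (ρ × ι) K →ₐ[K] B).toRingHom t
      (aeval (rowShift i j Polynomial.X (constEntry K ρ ι)) f) := by
  have : (aeval (rowShift i j t z) : MvPolynomial (ρ × ι) K →ₐ[K] B).toRingHom =
      (Polynomial.eval₂RingHom (aeval z : MvPolynomial (ρ × ι) K →ₐ[K] B).toRingHom t).comp
      (aeval (rowShift i j Polynomial.X (constEntry K ρ ι)) :
        MvPolynomial (ρ × ι) K →ₐ[K] _).toRingHom := by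
    apply MvPolynomial.ringHom_ext
    · intro a
      simp [MvPolynomial.algebraMap_eq, Polynomial.algebraMap_apply]
    · intro q
      simp only [rowShift, AlgHom.toRingHom_eq_coe, RingHom.coe_coe, RingHom.coe_comp,
        Function.comp, aeval_X, Polynomial.coe_eval₂RingHom, Polynomial.eval₂_add,
        Polynomial.eval₂_C]
      split_ifs <;> simp [mul_comm t]
  exact RingHom.congr_fun this f

theorem RowShiftInvariant.aeval_rowShift [DecidableEq ρ] {B : Type*} [CommRing B] [Algebra K B]
    {i j : ρ} {f : MvPolynomial (ρ × ι) K} (hf : RowShiftInvariant i j f) (z : ρ × ι → B) (t : B) :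
    aeval (rowShift i j t z) f = aeval z f := by
  rw [aeval_rowShift_eq_eval₂, hf]
  simp

theorem RowHomogeneous.aeval_scale [DecidableEq ρ] [Fintype ρ] [Fintype ι] {B : Type*}
    [CommRing B] [Algebra K B]
    {s : ρ} {f : MvPolynomial (ρ × ι) K} {D : ℕ} (hf : RowHomogeneous s f D) (z : ρ × ι → B) (t : B) :
    aeval (fun q => if q.1 = s then t * z q else z q) f = t ^ D * aeval z f := by
  rw [aeval_def, aeval_def, eval₂_eq', eval₂_eq', Finset.mul_sum]
  refine Finset.sum_congr rfl fun μ hμ => ?_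
  have : ∏ q, (if q.1 = s then t * z q else z q) ^ μ q = t ^ D * ∏ q, z q ^ μ q := by
    rw [← hf μ hμ, ← Finset.prod_pow_eq_pow_sum]
    simp_rw [Fintype.prod_prod_type]
    rw [Fintype.prod_eq_mul_prod_compl s, Fintype.prod_eq_mul_prod_compl s, ← mul_assoc,
      ← Finset.prod_mul_distrib]
    congr 1
    · exact Finset.prod_congr rfl fun m _ => by simp [mul_pow]
    · refine Finset.prod_congr rfl fun l hl => Finset.prod_congr rfl fun m _ => ?_
      simp only [Finset.mem_compl, Finset.mem_singleton] at hl
      simp [hl]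
  rw [this]
  ring

/-- If `h (x, y - t x)` has degree at most `n` in `t`, where `x` and `y` are the rows `i` and `j`,
then the degree of `h` in `y` is at most its degree in `x` plus `n`. -/
theorem rowDegree_le_of_natDegree_rowShift_le [DecidableEq ρ] [Fintype ρ] [Fintype ι] {i j : ρ}
    (hij : i ≠ j) {h : MvPolynomial (ρ × ι) K} (h0 : h ≠ 0) {p q n : ℕ}
    (hp : RowHomogeneous i h p) (hq : RowHomogeneous j h q)
    (hn : (aeval (rowShift i j (-Polynomial.X) (constEntry K ρ ι)) h :
      Polynomial (MvPolynomial (ρ × ι) K)).natDegree ≤ n) : q ≤ p + n := by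
  obtain ⟨U, hU⟩ : ∃ U : Polynomial (MvPolynomial (ρ × ι) K),
    U = aeval (rowShift i j (-Polynomial.X) (constEntry K ρ ι)) h := ⟨_, rfl⟩
  rw [← hU] at hn
  -- With rows `x`, `y` and a new variable `T`, `g = h(x + T y, -x)`. Put `x' = x + T y`. Since `-x
  -- = T (y - T⁻¹ x')`, homogeneity gives `g = T ^ q * h(x', y - T⁻¹ x')`, which is `T ^ q` times
  -- `U` at `T⁻¹`. As `g` has degree at most `p` in `T`, this bounds `q`.
  let zg : ρ × ι → Polynomial (MvPolynomial (ρ × ι) K) := fun q =>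
    if q.1 = i then Polynomial.C (X (i, q.2)) + Polynomial.X * Polynomial.C (X (j, q.2))
    else if q.1 = j then - constEntry K ρ ι (i, q.2) else Polynomial.C (X q)
  let g : Polynomial (MvPolynomial (ρ × ι) K) := aeval zg h
  let z1 : ρ × ι → Polynomial (MvPolynomial (ρ × ι) K) := fun q =>
    if q.1 = i then Polynomial.C (X (i, q.2)) + Polynomial.X * Polynomial.C (X (j, q.2))
    else Polynomial.C (X q)
  -- At `T = 1` the substitution `(x + y, -x)` is invertible.
  have hg0 : g ≠ 0 := by
    intro hg
    apply h0
    have h1 : aeval (fun q : ρ × ι => if q.1 = i then - X (j, q.2)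
        else if q.1 = j then X (i, q.2) + X (j, q.2) else X q : ρ × ι → MvPolynomial (ρ × ι) K)
        (Polynomial.eval 1 g) = h := by
      have : ((aeval (fun q : ρ × ι => if q.1 = i then - X (j, q.2)
        else if q.1 = j then X (i, q.2) + X (j, q.2) else X q : ρ × ι → MvPolynomial (ρ × ι) K)).toRingHom.comp
        ((Polynomial.evalRingHom (1 : MvPolynomial (ρ × ι) K)).comp (aeval zg : MvPolynomial (ρ × ι) K →ₐ[K] _).toRingHom)) = RingHom.id (MvPolynomial (ρ × ι) K) := by
        apply MvPolynomial.ringHom_ext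
        · intro a
          simp [MvPolynomial.algebraMap_eq, Polynomial.algebraMap_apply]
        · rintro ⟨l, m⟩
          by_cases hi : l = i
          · subst hi; simp [zg, hij.symm]
          · by_cases hj : l = j
            · subst hj; simp [zg, hi]
            · simp [zg, hi, hj]
      exact RingHom.congr_fun this h
    rw [← h1, hg]
    simp
  have hgdeg : g.natDegree ≤ p := by
    simp only [g, aeval_def, eval₂_eq']
    refine Polynomial.natDegree_sum_le_of_forall_le _ _ fun μ hμ => ?_
    have hC : (algebraMap K (Polynomial (MvPolynomial (ρ × ι) K))) (coeff μ h) = Polynomial.C (algebraMap K (MvPolynomial (ρ × ι) K) (coeff μ h)) := rfl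
    rw [hC]
    refine (Polynomial.natDegree_C_mul_le _ _).trans ((Polynomial.natDegree_prod_le _ _).trans ?_)
    rw [← hp μ hμ, Fintype.sum_prod_type, Fintype.sum_eq_add_sum_compl i]
    have : ∑ x ∈ {i}ᶜ, ∑ y, (zg (x, y) ^ μ (x, y)).natDegree = 0 := by
      refine Finset.sum_eq_zero fun l hl => Finset.sum_eq_zero fun m _ => ?_
      simp only [Finset.mem_compl, Finset.mem_singleton] at hl
      refine Nat.le_zero.1 (Polynomial.natDegree_pow_le.trans ?_)
      simp only [zg, hl, if_false]
      split_ifs <;> simp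
    rw [this, add_zero]
    refine Finset.sum_le_sum fun m _ => Polynomial.natDegree_pow_le.trans ?_
    have : (zg (i, m)).natDegree ≤ 1 := by
      simp only [zg, if_true]
      refine (Polynomial.natDegree_add_le _ _).trans ?_
      simp only [Polynomial.natDegree_C, zero_le, sup_of_le_right]
      refine Polynomial.natDegree_mul_le.trans ?_
      simp
    nlinarith
  let Ω := FractionRing (Polynomial (MvPolynomial (ρ × ι) K))
  let φ : Polynomial (MvPolynomial (ρ × ι) K) →+* Ω := algebraMap (Polynomial (MvPolynomial (ρ × ι) K)) Ω
  have hφ : Function.Injective φ := IsFractionRing.injective _ _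
  let T : Ω := φ Polynomial.X
  have hT : T ≠ 0 := by
    intro hT
    exact Polynomial.X_ne_zero (hφ (hT.trans (map_zero φ).symm))
  let ψ : MvPolynomial (ρ × ι) K →+* Polynomial (MvPolynomial (ρ × ι) K) := (aeval z1 : MvPolynomial (ρ × ι) K →ₐ[K] _).toRingHom
  let w : Polynomial (MvPolynomial (ρ × ι) K) := ∑ e ∈ Finset.range (n + 1), ψ (U.coeff e) * Polynomial.X ^ (n - e)
  -- The factor `T ^ n` clears the powers of `T⁻¹` in `U`.
  have key : Polynomial.X ^ n * g = Polynomial.X ^ q * w := by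
    apply hφ
    have e1 : φ g = aeval (fun q => φ (zg q)) h := by
      simp only [g]
      exact (comp_aeval_apply zg (IsScalarTower.toAlgHom K (Polynomial (MvPolynomial (ρ × ι) K)) Ω) h)
    have e2 : (fun q => φ (zg q)) = fun q => if q.1 = j then
        T * rowShift i j (-T⁻¹) (fun q => φ (z1 q)) q else
        rowShift i j (-T⁻¹) (fun q => φ (z1 q)) q := by
      funext ⟨l, m⟩
      by_cases hi : l = i
      · subst hi; simp [zg, z1, rowShift, hij]
      · by_cases hj : l = j
        · subst hj
          simp only [zg, z1, rowShift, hi, if_true, if_false, map_neg, map_add, map_mul]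
          rw [mul_add, ← mul_assoc, mul_neg, mul_inv_cancel₀ hT]
          simp only [T]
          ring
        · simp [zg, z1, rowShift, hi, hj]
    have e3 : aeval (rowShift i j (-T⁻¹) (fun q => φ (z1 q))) h =
        U.eval₂ (φ.comp ψ) T⁻¹ := by
      have hU' : U = Polynomial.eval₂ Polynomial.C (-Polynomial.X)
          (aeval (rowShift i j Polynomial.X (constEntry K ρ ι)) h) := by
        rw [hU, aeval_rowShift_eq_eval₂ h]
        congr 1
        apply MvPolynomial.ringHom_ext
        · intro a
          simp [Polynomial.algebraMap_apply, MvPolynomial.algebraMap_eq]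
        · intro q
          simp
      rw [aeval_rowShift_eq_eval₂ h, hU', ← Polynomial.coe_eval₂RingHom, ← Polynomial.coe_eval₂RingHom,
        ← Polynomial.coe_eval₂RingHom, ← RingHom.comp_apply]
      congr 1
      apply Polynomial.ringHom_ext'
      · apply MvPolynomial.ringHom_ext
        · intro a
          simp [ψ, MvPolynomial.algebraMap_eq]
          rfl
        · intro q
          simp [ψ]
      · simp
    rw [map_mul, map_mul, map_pow, map_pow, e1, e2, hq.aeval_scale, e3,
      Polynomial.eval₂_eq_sum_range' _ (Nat.lt_succ_of_le hn)]
    rw [map_sum]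
    simp only [map_mul, map_pow, Finset.mul_sum]
    refine Finset.sum_congr rfl fun e he => ?_
    have he : e ≤ n := by simpa [Nat.lt_succ_iff] using he
    change T ^ n * (T ^ q * (φ (ψ _) * _)) = T ^ q * (φ (ψ _) * T ^ (n - e))
    rw [pow_sub₀ _ hT he, inv_pow]
    ring
  by_contra hlt
  push Not at hlt
  obtain ⟨e, he⟩ : ∃ e, q = n + e := ⟨q - n, by omega⟩
  rw [he, pow_add, mul_assoc] at key
  have key2 := mul_left_cancel₀ (pow_ne_zero n Polynomial.X_ne_zero) key
  have hw : w ≠ 0 := by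
    rintro hw
    exact hg0 (by rw [key2, hw, mul_zero])
  rw [key2, Polynomial.natDegree_X_pow_mul _ hw] at hgdeg
  omega

end RowShift

/-! ### Coefficients with respect to a subset of the variables. -/

section Slice

variable {K : Type*} [Field K] {σ : Type*}

open Classical in
/-- The coefficient in `f` of the monomial with exponent `N`, when only the variables in `p` are
considered as variables. -/
def slice (p : σ → Prop) [DecidablePred p] (N : σ →₀ ℕ) (f : MvPolynomial σ K) : MvPolynomial σ K :=
  ∑ μ ∈ f.support with μ.filter p = N, monomial (μ.filter (¬ p ·)) (f.coeff μ)

variable {p : σ → Prop} [DecidablePred p] {N : σ →₀ ℕ} {f : MvPolynomial σ K}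

theorem exists_of_mem_support_slice {ν : σ →₀ ℕ} (hν : ν ∈ (slice p N f).support) :
    ∃ μ ∈ f.support, μ.filter p = N ∧ μ.filter (¬ p ·) = ν := by
  classical
  by_contra! h
  rw [mem_support_iff, slice, coeff_sum] at hν
  refine hν (Finset.sum_eq_zero fun μ hμ => ?_)
  rw [Finset.mem_filter] at hμ
  rw [coeff_monomial, if_neg (h μ hμ.1 hμ.2)]

/-- No cancellation occurs: an exponent is determined by its parts inside and outside `p`. -/
theorem mem_support_slice {μ : σ →₀ ℕ} (hμ : μ ∈ f.support) :
    μ.filter (¬ p ·) ∈ (slice p (μ.filter p) f).support := by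
  classical
  rw [mem_support_iff, slice, coeff_sum, Finset.sum_eq_single μ]
  · rw [coeff_monomial, if_pos rfl]
    exact mem_support_iff.1 hμ
  · intro μ' hμ' hne
    rw [coeff_monomial, if_neg]
    rw [Finset.mem_filter] at hμ'
    intro h
    apply hne
    rw [← Finsupp.filter_add_filter_not μ' p, ← Finsupp.filter_add_filter_not μ p, hμ'.2, h]
  · intro h
    exact (h (Finset.mem_filter.2 ⟨hμ, rfl⟩)).elim

/-- Evaluation where the variables in `p` and those not in `p` are kept apart. -/
theorem aeval_ite_eq_sum [Fintype σ] {τ B : Type*} [CommRing B] [Algebra K B]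
    (f : MvPolynomial σ K) (e : σ → MvPolynomial τ B) (y : σ → B) :
    aeval (fun q => if p q then e q else C (y q)) f =
      ∑ μ ∈ f.support, (∏ q, e q ^ (μ.filter p) q) *
        C (aeval y (monomial (μ.filter (¬ p ·)) (f.coeff μ))) := by
  rw [aeval_def, eval₂_eq']
  refine Finset.sum_congr rfl fun μ _ => ?_
  rw [aeval_monomial, Finsupp.prod_fintype _ _ (by simp), map_mul, map_prod, mul_left_comm,
    ← Finset.prod_mul_distrib, IsScalarTower.algebraMap_apply K B (MvPolynomial τ B),
    MvPolynomial.algebraMap_eq]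
  congr 1
  refine Finset.prod_congr rfl fun q _ => ?_
  by_cases h : p q <;> simp [h]

/-- The coefficient of a given monomial in an evaluation with monic values is a slice. -/
theorem coeff_sum_mul_C_eq_slice {τ B : Type*} [CommRing B] [Algebra K B]
    (u : (σ →₀ ℕ) → MvPolynomial τ B) (N : σ →₀ ℕ) (M : τ →₀ ℕ) (y : σ → B)
    (h1 : ∀ μ ∈ f.support, μ.filter p = N → (u μ).coeff M = 1)
    (h0 : ∀ μ ∈ f.support, μ.filter p ≠ N → (u μ).coeff M = 0) :
    coeff M (∑ μ ∈ f.support, u μ * C (aeval y (monomial (μ.filter (¬ p ·)) (f.coeff μ)))) =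
      aeval y (slice p N f) := by
  classical
  rw [slice, coeff_sum, map_sum, Finset.sum_filter]
  refine Finset.sum_congr rfl fun μ hμ => ?_
  rw [mul_comm (u μ), coeff_C_mul, mul_comm]
  split_ifs with h
  · rw [h1 μ hμ h, one_mul]
  · rw [h0 μ hμ h, zero_mul]

end Slice

/-! ### Ballot inequality at a single column. -/

section RowShift

variable {K : Type*} [Field K] {ρ ι : Type*}

theorem RowHomogeneous.slice [Fintype ι] {s : ρ} {f : MvPolynomial (ρ × ι) K} {D : ℕ}
    (hf : RowHomogeneous s f D) (p : ρ × ι → Prop) [DecidablePred p] (N : ρ × ι →₀ ℕ) :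
    RowHomogeneous s (slice p N f) (D - ∑ m, N (s, m)) := by
  classical
  intro ν hν
  obtain ⟨μ, hμ, h1, h2⟩ := exists_of_mem_support_slice hν
  have := hf μ hμ
  rw [← Finsupp.filter_add_filter_not μ p, h1, h2] at this
  simp only [Finsupp.add_apply, Finset.sum_add_distrib] at this
  omega

theorem RowHomogeneous.sum_le [Fintype ι] {s : ρ} {f : MvPolynomial (ρ × ι) K} {D : ℕ}
    (hf : RowHomogeneous s f D) {p : ρ × ι → Prop} [DecidablePred p] {N : ρ × ι →₀ ℕ}
    (h0 : Chow.slice p N f ≠ 0) : ∑ m, N (s, m) ≤ D := by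
  classical
  obtain ⟨ν, hν⟩ := support_nonempty.2 h0
  obtain ⟨μ, hμ, h1, h2⟩ := exists_of_mem_support_slice hν
  have := hf μ hμ
  rw [← Finsupp.filter_add_filter_not μ p, h1, h2] at this
  simp only [Finsupp.add_apply, Finset.sum_add_distrib] at this
  omega

variable [DecidableEq ρ] [Fintype ρ] [Fintype ι]

theorem monomial_eq_prod_X_pow {σ B : Type*} [Fintype σ] [CommRing B] (μ : σ →₀ ℕ) :
    (∏ q, X q ^ μ q : MvPolynomial σ B) = monomial μ 1 := by
  rw [MvPolynomial.monomial_eq, Finsupp.prod_fintype _ _ (by simp), C_1, one_mul]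

/-- Consider a polynomial that is invariant under adding multiples of row `i` to row `j`. If the
exponent of `(j, c)` in one of its monomials is as large as possible, then that monomial satisfies
a ballot inequality. -/
theorem RowShiftInvariant.add_le_of_forall_le {i j : ρ} (hij : i ≠ j)
    {v : MvPolynomial (ρ × ι) K} (hv : RowShiftInvariant i j v) {P Q : ℕ}
    (hP : RowHomogeneous i v P) (hQ : RowHomogeneous j v Q) (c : ι) {ν : ρ × ι →₀ ℕ}
    (hν : ν ∈ v.support)
    (hmax : ∀ ν' ∈ v.support, (∀ l, l ≠ i → l ≠ j → ν' (l, c) = ν (l, c)) →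
      ν' (i, c) + ν' (j, c) = ν (i, c) + ν (j, c) → ν' (j, c) ≤ ν (j, c)) :
    Q + ν (i, c) ≤ P := by
  classical
  -- Put `0` at `(j, c)` and replace row `j` by row `j` minus `t` times row `i` in the other
  -- columns. Shifting by `t` restores these columns and puts `t * X (i, c)` at `(j, c)`. Invariance
  -- equates the two values of `v`; the coefficients of the column monomial `M` are compared.
  let p : ρ × ι → Prop := fun q => q.2 = c
  let M : ρ × ι →₀ ℕ := Finsupp.equivFunOnFinite.symm fun q => if q.2 = c then
    if q.1 = j then 0 else if q.1 = i then ν (i, c) + ν (j, c) else ν q else 0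
  have hM : ∀ q, M q = if q.2 = c then
    if q.1 = j then 0 else if q.1 = i then ν (i, c) + ν (j, c) else ν q else 0 := fun q => rfl
  let y : ρ × ι → Polynomial (MvPolynomial (ρ × ι) K) := rowShift i j (-Polynomial.X) (constEntry K ρ ι)
  let e : ρ × ι → MvPolynomial (ρ × ι) (Polynomial (MvPolynomial (ρ × ι) K)) := fun q => if q.1 = j then 0 else X q
  let e' : ρ × ι → MvPolynomial (ρ × ι) (Polynomial (MvPolynomial (ρ × ι) K)) := fun q =>
    if q.1 = j then C Polynomial.X * X (i, q.2) else X q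
  have hshift : rowShift i j (C Polynomial.X) (fun q => if p q then e q else C (y q)) =
      fun q => if p q then e' q else C (constEntry K ρ ι q) := by
    funext ⟨l, m⟩
    by_cases hm : m = c
    · by_cases hl : l = j
      · subst hl; simp [rowShift, p, e, e', hm, hij]
      · simp [rowShift, p, e, e', hm, hl]
    · by_cases hl : l = j
      · subst hl; simp only [rowShift, p, hm, hij, y, if_true, if_false, map_add, map_mul, map_neg, add_zero]; ring
      · simp [rowShift, p, hm, hl, y]
  have key := hv.aeval_rowShift (fun q => if p q then e q else C (y q))
    (C Polynomial.X : MvPolynomial (ρ × ι) (Polynomial (MvPolynomial (ρ × ι) K)))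
  rw [hshift, aeval_ite_eq_sum, aeval_ite_eq_sum] at key
  have key := congrArg (coeff M) key
  have he : ∀ μ : ρ × ι →₀ ℕ, (∏ q, e q ^ (μ.filter p) q) =
      if μ (j, c) = 0 then monomial (μ.filter p) 1 else 0 := by
    intro μ
    split_ifs with h
    · rw [← monomial_eq_prod_X_pow]
      refine Finset.prod_congr rfl fun q _ => ?_
      by_cases hq : q.1 = j
      · have : (μ.filter p) q = 0 := by
          rw [Finsupp.filter_apply]
          split_ifs with h'
          · rw [← h, ← hq, ← show q.2 = c from h']
          · rfl
        rw [this, pow_zero, pow_zero]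
      · simp [e, hq]
    · refine Finset.prod_eq_zero (Finset.mem_univ (j, c)) ?_
      simp [e, p, h]
  rw [coeff_sum_mul_C_eq_slice (p := p) (f := v) _ M M y (fun μ _ h => ?_) (fun μ _ h => ?_)] at key
  rotate_left
  · have : μ (j, c) = 0 := by
      have := DFunLike.congr_fun h (j, c)
      simpa [hM, p] using this
    rw [he, if_pos this, h, coeff_monomial, if_pos rfl]
  · rw [he]
    split_ifs
    · rw [coeff_monomial, if_neg h]
    · simp
  -- After the shift the exponent of `(j, c)` is added to that of `(i, c)`, and the power of `t`
  -- remembers it.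
  let τ : (ρ × ι →₀ ℕ) → (ρ × ι →₀ ℕ) := fun μ => Finsupp.equivFunOnFinite.symm fun q =>
    if q.2 = c then if q.1 = j then 0 else if q.1 = i then μ (i, c) + μ (j, c) else μ q else 0
  have he' : ∀ μ : ρ × ι →₀ ℕ, (∏ q, e' q ^ (μ.filter p) q) =
      monomial (τ μ) (Polynomial.X ^ μ (j, c)) := by
    intro μ
    have h1 : ∀ q, e' q ^ (μ.filter p) q = (if q = (j, c) then
        (C Polynomial.X : MvPolynomial (ρ × ι) (Polynomial (MvPolynomial (ρ × ι) K))) ^ μ (j, c) else 1) *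
        ((if q = (j, c) then X (i, c) ^ μ (j, c) else 1) *
        (if q = (j, c) then 1 else X q ^ (μ.filter p) q)) := by
      rintro ⟨l, m⟩
      by_cases hm : m = c
      · subst hm
        by_cases hl : l = j
        · subst hl; simp [e', p, mul_pow]
        · simp [e', p, hl]
      · simp [e', p, hm]
    simp_rw [h1]
    rw [Finset.prod_mul_distrib, Finset.prod_mul_distrib, Finset.prod_ite_eq' _ _ (fun _ => _),
      if_pos (Finset.mem_univ _)]
    have h2 : (∏ q : ρ × ι, if q = (j, c) then (X (i, c) : MvPolynomial (ρ × ι) (Polynomial (MvPolynomial (ρ × ι) K))) ^ μ (j, c) else 1) =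
        ∏ q : ρ × ι, if q = (i, c) then X q ^ μ (j, c) else 1 := by
      rw [Finset.prod_ite_eq' _ _ (fun _ => _), Finset.prod_ite_eq' _ _ (fun q => X q ^ μ (j, c)),
        if_pos (Finset.mem_univ _), if_pos (Finset.mem_univ _)]
    rw [h2, ← Finset.prod_mul_distrib]
    have h3 : ∀ q : ρ × ι, ((if q = (i, c) then (X q : MvPolynomial (ρ × ι) (Polynomial (MvPolynomial (ρ × ι) K))) ^ μ (j, c) else 1) *
        if q = (j, c) then 1 else X q ^ (μ.filter p) q) = X q ^ (τ μ) q := by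
      rintro ⟨l, m⟩
      by_cases hm : m = c
      · subst hm
        by_cases hl : l = j
        · subst hl; simp [τ, hij.symm]
        · by_cases hi : l = i
          · subst hi; simp [τ, p, hl, pow_add, mul_comm]
          · simp [τ, p, hl, hi]
      · simp [τ, p, hm]
    simp_rw [h3]
    rw [monomial_eq_prod_X_pow, ← map_pow, C_mul_monomial, mul_one]
  have hτ : ∀ μ, τ μ = M → (∀ l, l ≠ i → l ≠ j → μ (l, c) = ν (l, c)) ∧
      μ (i, c) + μ (j, c) = ν (i, c) + ν (j, c) := by
    intro μ h
    refine ⟨fun l hi hj => ?_, ?_⟩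
    · have := DFunLike.congr_fun h (l, c)
      simpa [hM, τ, hi, hj] using this
    · have := DFunLike.congr_fun h (i, c)
      simpa [hM, τ, hij] using this
  have hC : ∀ g : MvPolynomial (ρ × ι) K, aeval (constEntry K ρ ι) g = Polynomial.C g := by
    intro g
    have := aeval_algebraMap_apply (A := MvPolynomial (ρ × ι) K)
      (Polynomial (MvPolynomial (ρ × ι) K)) X g
    rw [aeval_X_left_apply] at this
    exact this
  simp_rw [he', hC, coeff_sum, mul_comm _ (C _), coeff_C_mul, coeff_monomial] at key
  let E : Polynomial (MvPolynomial (ρ × ι) K) := ∑ x ∈ v.support with τ x = M, Polynomial.X ^ x (j, c) *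
    Polynomial.C (monomial (x.filter (¬ p ·)) (coeff x v))
  have hE : E = aeval y (slice p M v) := by
    rw [← key]
    simp only [E]
    rw [Finset.sum_filter]
    refine Finset.sum_congr rfl fun μ _ => ?_
    split_ifs
    · rw [mul_comm]
    · rw [mul_zero]
  have hdeg : E.natDegree ≤ ν (j, c) := by
    refine Polynomial.natDegree_sum_le_of_forall_le _ _ fun μ hμ => ?_
    rw [Finset.mem_filter] at hμ
    refine (Polynomial.natDegree_mul_C_le _ _).trans ?_
    rw [Polynomial.natDegree_X_pow]
    exact hmax μ hμ.1 (hτ μ hμ.2).1 (hτ μ hμ.2).2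
  -- The power of `t`, the exponent `M` and the part outside column `c` determine an exponent, so
  -- the term of `ν` cannot cancel.
  have hE0 : E ≠ 0 := by
    intro h
    have h := congrArg (fun F : Polynomial (MvPolynomial (ρ × ι) K) => coeff (ν.filter (¬ p ·)) (F.coeff (ν (j, c)))) h
    simp only [E, Polynomial.finsetSum_coeff, coeff_sum, Polynomial.coeff_mul_C,
      Polynomial.coeff_X_pow, Polynomial.coeff_zero, coeff_zero] at h
    rw [Finset.sum_eq_single ν] at h
    · rw [if_pos rfl, one_mul, coeff_monomial, if_pos rfl] at h
      exact mem_support_iff.1 hν h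
    · intro μ hμ hne
      rw [Finset.mem_filter] at hμ
      split_ifs with hj
      · rw [one_mul, coeff_monomial, if_neg]
        intro hr
        apply hne
        ext ⟨l, m⟩
        by_cases hm : m = c
        · subst hm
          by_cases hlj : l = j
          · rw [hlj, hj]
          · by_cases hli : l = i
            · have := (hτ μ hμ.2).2
              rw [hli]; omega
            · exact (hτ μ hμ.2).1 l hli hlj
        · have := DFunLike.congr_fun hr (l, m)
          simpa [p, hm] using this
      · simp
    · intro h'
      exact (h' (Finset.mem_filter.2 ⟨hν, rfl⟩)).elim
  have hs0 : slice p M v ≠ 0 := by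
    rintro h
    rw [hE, h, map_zero] at hE0
    exact hE0 rfl
  have hMi : ∑ m, M (i, m) = ν (i, c) + ν (j, c) := by
    simp [hM, hij]
  have hMj : ∑ m, M (j, m) = 0 := by
    simp [hM]
  -- The slice has degree `P - (ν (i, c) + ν (j, c))` in row `i` and `Q` in row `j`, and its shift
  -- has degree at most `ν (j, c)` in `t`.
  have h1 := rowDegree_le_of_natDegree_rowShift_le hij hs0 (hP.slice p M) (hQ.slice p M)
    (n := ν (j, c)) (by rw [← hE]; exact hdeg)
  have h2 := hP.sum_le hs0
  rw [hMi, hMj] at h1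
  rw [hMi] at h2
  omega

end RowShift

/-! ### Leading exponents of invariant polynomials. -/

section Ballot

variable {K : Type*} [Field K] {ρ ι : Type*} [LinearOrder ρ] [LinearOrder ι] [Fintype ρ] [Fintype ι]

/-- The lexicographic order in which the entries in the last column of a matrix count first, and
within a column the last entry counts first. -/
def columnOrder (ρ ι : Type*) [LinearOrder ρ] [LinearOrder ι] [Fintype ρ] [Fintype ι] :
    MonomialOrder (ρ × ι) where
  syn := Lex ((ι ×ₗ ρ)ᵒᵈ →₀ ℕ)
  toSyn := (Finsupp.domCongr (((Equiv.prodComm ρ ι).trans toLex).trans OrderDual.toDual)).trans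
    { toEquiv := toLex
      map_add' := toLex_add }
  toSyn_monotone := by
    intro a b h
    refine Finsupp.toLex_monotone fun q => ?_
    exact h _
  wellFoundedLT_syn := by
    have : Finite (ι ×ₗ ρ)ᵒᵈ := inferInstanceAs (Finite (ι × ρ))
    infer_instance

open scoped MonomialOrder

theorem columnOrder_lt_iff {μ ν : ρ × ι →₀ ℕ} : μ ≺[columnOrder ρ ι] ν ↔
    ∃ s m, (∀ m', m < m' → ∀ l, μ (l, m') = ν (l, m')) ∧ (∀ l, s < l → μ (l, m) = ν (l, m)) ∧
      μ (s, m) < ν (s, m) := by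
  refine (Finsupp.Lex.lt_iff (a := (columnOrder ρ ι).toSyn μ)
    (b := (columnOrder ρ ι).toSyn ν)).trans ?_
  have hval : ∀ (μ : ρ × ι →₀ ℕ) (q : (ι ×ₗ ρ)ᵒᵈ),
      (ofLex (show Lex ((ι ×ₗ ρ)ᵒᵈ →₀ ℕ) from (columnOrder ρ ι).toSyn μ)) q =
      μ ((ofLex (OrderDual.ofDual q)).2, (ofLex (OrderDual.ofDual q)).1) := fun _ _ => rfl
  simp only [hval]
  constructor
  · rintro ⟨q, h1, h2⟩
    refine ⟨(ofLex (OrderDual.ofDual q)).2, (ofLex (OrderDual.ofDual q)).1, fun m' hm l => ?_,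
      fun l hl => ?_, by simpa using h2⟩
    · have := h1 (OrderDual.toDual (toLex (m', l))) (OrderDual.toDual_lt.2 (Prod.Lex.lt_iff.2 (Or.inl hm)))
      simpa using this
    · have := h1 (OrderDual.toDual (toLex ((ofLex (OrderDual.ofDual q)).1, l)))
        (OrderDual.toDual_lt.2 (Prod.Lex.lt_iff.2 (Or.inr ⟨rfl, hl⟩)))
      simpa using this
  · rintro ⟨s, m, h1, h2, h3⟩
    refine ⟨OrderDual.toDual (toLex (m, s)), fun q hq => ?_, by simpa using h3⟩
    obtain ⟨⟨m', l⟩, rfl⟩ : ∃ a : ι × ρ, q = OrderDual.toDual (toLex a) := ⟨_, rfl⟩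
    rcases Prod.Lex.lt_iff.1 (OrderDual.toDual_lt.1 hq) with h | ⟨h, h'⟩
    · simpa using h1 m' h l
    · simp only [ofLex_toLex] at h h'
      subst h
      simpa using h2 l h'

/-- Truncation to the last columns respects the order. -/
theorem filter_le_filter_of_le {μ ν : ρ × ι →₀ ℕ} (h : μ ≼[columnOrder ρ ι] ν) (c : ι) :
    μ.filter (fun q => c < q.2) ≼[columnOrder ρ ι] ν.filter (fun q => c < q.2) := by
  rcases h.lt_or_eq with h | h
  · obtain ⟨s, m, h1, h2, h3⟩ := columnOrder_lt_iff.1 h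
    by_cases hm : c < m
    · refine le_of_lt (columnOrder_lt_iff.2 ⟨s, m, fun m' hm' l => ?_, fun l hl => ?_, ?_⟩)
      · simp [Finsupp.filter_apply, h1 m' hm' l]
      · simp [Finsupp.filter_apply, h2 l hl]
      · simpa [Finsupp.filter_apply, hm] using h3
    · refine le_of_eq (congrArg _ ?_)
      ext ⟨l, m'⟩
      simp only [Finsupp.filter_apply]
      split_ifs with hc
      · exact h1 m' (lt_of_le_of_lt (not_lt.1 hm) hc) l
      · rfl
  · rw [(columnOrder ρ ι).toSyn.injective h]

theorem monic_X_add_C_mul_X {B : Type*} [CommRing B] [IsDomain B] {q q' : ρ × ι}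
    (h : Finsupp.single q' 1 ≺[columnOrder ρ ι] Finsupp.single q 1) (t : B) :
    (columnOrder ρ ι).Monic (X q + C t * X q' : MvPolynomial (ρ × ι) B) ∧
      (columnOrder ρ ι).degree (X q + C t * X q' : MvPolynomial (ρ × ι) B) = Finsupp.single q 1 := by
  have hlt : (columnOrder ρ ι).degree (C t * X q' : MvPolynomial (ρ × ι) B) ≺[columnOrder ρ ι]
      (columnOrder ρ ι).degree (X q : MvPolynomial (ρ × ι) B) := by
    rw [MonomialOrder.degree_X]
    refine lt_of_le_of_lt ?_ h
    rw [X, C_mul_monomial]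
    exact MonomialOrder.degree_monomial_le _
  exact ⟨MonomialOrder.Monic.add_of_lt MonomialOrder.monic_X hlt, by
    rw [MonomialOrder.degree_add_of_lt hlt, MonomialOrder.degree_X]⟩

/-- This is why only shifts of an earlier row into a later one are used: they preserve leading
terms. -/
theorem single_lt_single {i j : ρ} (hij : i < j) (m : ι) :
    Finsupp.single (i, m) 1 ≺[columnOrder ρ ι] Finsupp.single (j, m) 1 := by
  refine columnOrder_lt_iff.2 ⟨j, m, fun m' hm' l => ?_, fun l hl => ?_, ?_⟩
  · rw [Finsupp.single_apply, Finsupp.single_apply, if_neg, if_neg] <;> simp [hm'.ne]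
  · rw [Finsupp.single_apply, Finsupp.single_apply, if_neg, if_neg] <;>
      simp [hl.ne, (hij.trans hl).ne]
  · simp [hij.ne]

/-- The leading coefficient of an invariant polynomial with respect to the last columns is
invariant. -/
theorem RowShiftInvariant.slice_leading {i j : ρ} (hij : i < j) {f : MvPolynomial (ρ × ι) K}
    (hf : RowShiftInvariant i j f) (c : ι) :
    RowShiftInvariant i j (slice (fun q => c < q.2)
      (((columnOrder ρ ι).degree f).filter (fun q => c < q.2)) f) := by
  -- The variables in the columns after `c` are kept as variables. The shift sends them to monic
  -- polynomials with the same leading terms, so at the highest exponent `M` it acts only on the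
  -- coefficient, which is the slice.
  let p : ρ × ι → Prop := fun q => c < q.2
  let M : ρ × ι →₀ ℕ := ((columnOrder ρ ι).degree f).filter p
  let y : ρ × ι → Polynomial (MvPolynomial (ρ × ι) K) :=
    rowShift i j Polynomial.X (constEntry K ρ ι)
  let e : ρ × ι → MvPolynomial (ρ × ι) (Polynomial (MvPolynomial (ρ × ι) K)) := fun q =>
    if q.1 = j then X q + C Polynomial.X * X (i, q.2) else X q
  have hshift : rowShift i j (C Polynomial.X) (fun q => if p q then X q else C (constEntry K ρ ι q)) =
      fun q => if p q then e q else C (y q) := by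
    funext ⟨l, m⟩
    by_cases hm : c < m
    · by_cases hl : l = j
      · subst hl; simp [rowShift, p, e, hm]
      · simp [rowShift, p, e, hm, hl]
    · by_cases hl : l = j
      · subst hl
        simp only [rowShift, p, hm, y, if_true, if_false, map_add, map_mul]
      · simp only [rowShift, p, hm, hl, y, if_false, map_add, map_zero]
  have key := hf.aeval_rowShift (fun q => if p q then X q else C (constEntry K ρ ι q))
    (C Polynomial.X : MvPolynomial (ρ × ι) (Polynomial (MvPolynomial (ρ × ι) K)))
  rw [hshift, aeval_ite_eq_sum, aeval_ite_eq_sum] at key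
  have key := congrArg (coeff M) key
  have hC : ∀ g : MvPolynomial (ρ × ι) K, aeval (constEntry K ρ ι) g = Polynomial.C g := by
    intro g
    have := aeval_algebraMap_apply (A := MvPolynomial (ρ × ι) K)
      (Polynomial (MvPolynomial (ρ × ι) K)) X g
    rw [aeval_X_left_apply] at this
    exact this
  have he : ∀ q, (columnOrder ρ ι).Monic (e q) ∧
      (columnOrder ρ ι).degree (e q) = Finsupp.single q 1 := by
    rintro ⟨l, m⟩
    simp only [e]
    split_ifs with h
    · subst h
      exact monic_X_add_C_mul_X (single_lt_single hij m) _
    · exact ⟨MonomialOrder.monic_X, MonomialOrder.degree_X⟩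
  have he' : ∀ μ : ρ × ι →₀ ℕ, (columnOrder ρ ι).Monic (∏ q, e q ^ μ q) ∧
      (columnOrder ρ ι).degree (∏ q, e q ^ μ q) = μ := by
    intro μ
    refine ⟨MonomialOrder.Monic.prod fun q _ => (he q).1.pow, ?_⟩
    rw [MonomialOrder.degree_prod fun q _ => pow_ne_zero _ (he q).1.ne_zero]
    simp_rw [MonomialOrder.degree_pow, (he _).2]
    simp [Finsupp.univ_sum_single]
  rw [coeff_sum_mul_C_eq_slice (p := p) (f := f) _ M M _ (fun μ _ h => ?_) (fun μ hμ h => ?_),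
    coeff_sum_mul_C_eq_slice (p := p) (f := f) _ M M _ (fun μ _ h => ?_) (fun μ _ h => ?_), hC] at key
  · exact key
  · rw [monomial_eq_prod_X_pow, coeff_monomial, if_pos h]
  · rw [monomial_eq_prod_X_pow, coeff_monomial, if_neg h]
  · have := (he' (μ.filter p)).1.coeff_degree
    rw [(he' _).2] at this
    rw [← h]
    exact this
  · refine MonomialOrder.coeff_eq_zero_of_lt (m := columnOrder ρ ι) ?_
    rw [(he' _).2]
    refine lt_of_le_of_ne (filter_le_filter_of_le (MonomialOrder.le_degree hμ) c) ?_
    intro h'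
    exact h ((columnOrder ρ ι).toSyn.injective h')

/-- The leading exponent of an invariant polynomial satisfies the ballot inequalities. -/
theorem RowShiftInvariant.sum_le_sum {i j : ρ} (hij : i < j) {f : MvPolynomial (ρ × ι) K}
    (hf : RowShiftInvariant i j f) {D : ℕ} (hi : RowHomogeneous i f D) (hj : RowHomogeneous j f D)
    (c : ι) : ∑ m with c ≤ m, (columnOrder ρ ι).degree f (i, m) ≤
      ∑ m with c < m, (columnOrder ρ ι).degree f (j, m) := by
  by_cases f0 : f = 0
  · simp [f0]
  set μ := (columnOrder ρ ι).degree f with hμ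
  have hμs : μ ∈ f.support := MonomialOrder.degree_mem_support f0
  let p : ρ × ι → Prop := fun q => c < q.2
  have hv := hf.slice_leading hij c
  rw [← hμ] at hv
  have hν : μ.filter (¬ p ·) ∈ (slice p (μ.filter p) f).support := mem_support_slice hμs
  -- The slice has degree `D - ∑ m with c < m, μ (s, m)` in each row `s`; the one-column inequality
  -- then rearranges to the claim.
  have h1 := hv.add_le_of_forall_le hij.ne (hi.slice p (μ.filter p)) (hj.slice p (μ.filter p)) c hν
    (fun ν' hν' hl hs => ?_)
  · have hs : ∀ l, ∑ m, (μ.filter p) (l, m) = ∑ m with c < m, μ (l, m) := by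
      intro l
      rw [Finset.sum_filter]
      rfl
    have hi' := hi.sum_le (p := p) (N := μ.filter p) (ne_zero_iff.2 ⟨_, mem_support_iff.1 hν⟩)
    have hj' := hj.sum_le (p := p) (N := μ.filter p) (ne_zero_iff.2 ⟨_, mem_support_iff.1 hν⟩)
    rw [hs, hs] at h1
    rw [hs] at hi' hj'
    have h2 : (μ.filter (¬ p ·)) (i, c) = μ (i, c) := by simp [p]
    rw [h2] at h1
    have h3 : ∑ m with c ≤ m, μ (i, m) = μ (i, c) + ∑ m with c < m, μ (i, m) := by
      rw [← Finset.sum_insert (s := Finset.univ.filter (c < ·)) (f := fun m => μ (i, m)) (by simp)]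
      refine Finset.sum_congr ?_ fun _ _ => rfl
      ext m
      simp [le_iff_eq_or_lt, eq_comm]
    omega
  -- A larger exponent at `(j, c)` would beat the leading exponent: the columns after `c` agree, and
  -- so do the entries of column `c` in rows after `j`, since these differ from both `i` and `j`.
  · obtain ⟨μ', hμ', h1, h2⟩ := exists_of_mem_support_slice hν'
    have hle : μ' ≼[columnOrder ρ ι] μ := MonomialOrder.le_degree hμ'
    by_contra! hlt
    refine not_lt.2 hle ?_
    have hval : ∀ l, ν' (l, c) = μ' (l, c) := by
      intro l
      rw [← h2]
      simp
    have hval' : ∀ l, (μ.filter (¬ p ·)) (l, c) = μ (l, c) := by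
      intro l
      simp [p]
    rw [hval, hval'] at hlt
    refine columnOrder_lt_iff.2 ⟨j, c, fun m' hm' l => ?_, fun l hl' => ?_, hlt⟩
    · have := DFunLike.congr_fun h1 (l, m')
      simpa [p, hm'] using this.symm
    · have := hl l (hij.trans hl').ne' hl'.ne'
      rw [hval, hval'] at this
      exact this.symm

end Ballot

/-! ### Minors and the first fundamental theorem. -/

section Brackets

/-- The weight that counts the entries of row `s`. -/
def rowWeight {r : ℕ} (ι : Type*) (s : Fin r) : Fin r × ι → ℕ := fun q => if q.1 = s then 1 else 0

theorem weight_rowWeight {ι : Type*} [Fintype ι] {r : ℕ} (s : Fin r) (μ : Fin r × ι →₀ ℕ) :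
    Finsupp.weight (rowWeight ι s) μ = ∑ m, μ (s, m) := by
  rw [Finsupp.weight_apply, Finsupp.sum_fintype _ _ (by simp), Fintype.sum_prod_type,
    Fintype.sum_eq_single s]
  · simp [rowWeight]
  · intro l hl
    simp [rowWeight, hl]

theorem rowHomogeneous_iff {K : Type*} [Field K] {ι : Type*} [Fintype ι] {r : ℕ} {s : Fin r}
    {f : MvPolynomial (Fin r × ι) K} {D : ℕ} :
    RowHomogeneous s f D ↔ IsWeightedHomogeneous (rowWeight ι s) f D := by
  simp only [RowHomogeneous, IsWeightedHomogeneous, weight_rowWeight, mem_support_iff]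

variable {K : Type*} [Field K] {ι : Type*} [LinearOrder ι] {r : ℕ}

theorem aeval_substMinors {B : Type*} [CommRing B] [Algebra K B] (z : Fin r × ι → B)
    (F : MvPolynomial (Fin r ↪o ι) K) :
    aeval z (substMinors F) = aeval (pluckerVector (Matrix.of fun i j => z (i, j))) F := by
  rw [substMinors, comp_aeval_apply]
  congr 2
  funext I
  rw [pluckerVector, AlgHom.map_det, pluckerVector]
  congr 1
  ext i j
  simp

theorem pluckerVector_rowShift {B : Type*} [CommRing B] {i j : Fin r} (hij : i ≠ j) (t : B)
    (z : Fin r × ι → B) :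
    pluckerVector (Matrix.of fun l m => rowShift i j t z (l, m)) =
      pluckerVector (Matrix.of fun l m => z (l, m)) := by
  funext I
  rw [pluckerVector, pluckerVector]
  rw [← Matrix.det_updateRow_add_smul_self ((Matrix.of fun l m => z (l, m)).submatrix id I)
    hij.symm t]
  congr 1
  ext l m
  by_cases hl : l = j
  · subst hl; simp [rowShift]
  · simp [rowShift, hl]

theorem rowShiftInvariant_substMinors {i j : Fin r} (hij : i ≠ j)
    (F : MvPolynomial (Fin r ↪o ι) K) : RowShiftInvariant i j (substMinors F) := by
  rw [RowShiftInvariant, aeval_substMinors, pluckerVector_rowShift hij, ← aeval_substMinors]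
  have := aeval_algebraMap_apply (A := MvPolynomial (Fin r × ι) K)
    (Polynomial (MvPolynomial (Fin r × ι) K)) X (substMinors F)
  rw [aeval_X_left_apply] at this
  exact this

theorem minor_eq_sum (I : Fin r ↪o ι) :
    (pluckerVector (Matrix.of fun i j => (X (i, j) : MvPolynomial (Fin r × ι) K))) I =
      ∑ τ : Equiv.Perm (Fin r), monomial (∑ s, Finsupp.single (τ s, I s) 1)
        ((Equiv.Perm.sign τ : ℤ) : K) := by
  rw [pluckerVector, Matrix.det_apply']
  refine Finset.sum_congr rfl fun τ _ => ?_
  rw [monomial_eq, ← map_intCast (C : K →+* MvPolynomial (Fin r × ι) K)]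
  congr 1
  rw [← Finsupp.prod_finsetSum_index (by simp) (by simp [pow_add])]
  simp

theorem sum_single_apply (τ : Equiv.Perm (Fin r)) (I : Fin r ↪o ι) (l s : Fin r) :
    (∑ s, Finsupp.single (τ s, I s) 1 : Fin r × ι →₀ ℕ) (l, I s) = if τ s = l then 1 else 0 := by
  rw [Finsupp.finsetSum_apply, Finset.sum_eq_single s]
  · simp [Finsupp.single_apply]
  · intro s' _ h
    rw [Finsupp.single_apply, if_neg]
    simp [h]
  · simp

theorem sum_single_apply_of_notMem (τ : Equiv.Perm (Fin r)) (I : Fin r ↪o ι) (l : Fin r) {m : ι}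
    (hm : m ∉ Set.range I) :
    (∑ s, Finsupp.single (τ s, I s) 1 : Fin r × ι →₀ ℕ) (l, m) = 0 := by
  rw [Finsupp.finsetSum_apply, Finset.sum_eq_zero]
  intro s' _
  rw [Finsupp.single_apply, if_neg]
  rintro h
  exact hm ⟨s', (Prod.ext_iff.1 h).2⟩

variable [Fintype ι]

theorem rowHomogeneous_substMinors (s : Fin r) {F : MvPolynomial (Fin r ↪o ι) K} {D : ℕ}
    (hF : F.IsHomogeneous D) : RowHomogeneous s (substMinors F) D := by
  rw [rowHomogeneous_iff, substMinors, aeval_def, eval₂_eq]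
  refine IsWeightedHomogeneous.sum _ _ _ fun d hd => ?_
  refine IsWeightedHomogeneous.C_mul ?_ _
  have hdeg : ∑ I ∈ d.support, d I = D := by
    have := hF (mem_support_iff.1 hd)
    simpa [Finsupp.weight_apply, Finsupp.sum] using this
  rw [← hdeg]
  refine IsWeightedHomogeneous.prod _ _ _ fun I _ => ?_
  have h1 : IsWeightedHomogeneous (rowWeight ι s)
      ((pluckerVector (Matrix.of fun i j => (X (i, j) : MvPolynomial (Fin r × ι) K))) I) 1 := by
    rw [minor_eq_sum]
    refine IsWeightedHomogeneous.sum _ _ _ fun τ _ => ?_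
    refine isWeightedHomogeneous_monomial _ _ _ ?_
    rw [weight_rowWeight]
    simp only [Finsupp.finsetSum_apply, Finsupp.single_apply, Prod.mk.injEq]
    rw [Finset.sum_comm, Finset.sum_eq_single (τ.symm s)]
    · simp
    · intro l _ hl
      refine Finset.sum_eq_zero fun m _ => if_neg ?_
      rintro ⟨h, -⟩
      exact hl (by rw [← h, Equiv.symm_apply_apply])
    · simp
  simpa using h1.pow (d I)

open scoped MonomialOrder

theorem sum_single_lt {τ : Equiv.Perm (Fin r)} (hτ : τ ≠ 1) (I : Fin r ↪o ι) :
    (∑ s, Finsupp.single (τ s, I s) 1) ≺[columnOrder (Fin r) ι]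
      (∑ s, Finsupp.single ((1 : Equiv.Perm (Fin r)) s, I s) 1) := by
  classical
  have hne : (Finset.univ.filter fun s => τ s ≠ s).Nonempty := by
    by_contra h
    rw [Finset.not_nonempty_iff_eq_empty, Finset.filter_eq_empty_iff] at h
    exact hτ (Equiv.ext fun s => not_not.1 (h (Finset.mem_univ s)))
  obtain ⟨s, hs, hmax⟩ : ∃ s, τ s ≠ s ∧ ∀ s', s < s' → τ s' = s' := by
    refine ⟨(Finset.univ.filter fun s => τ s ≠ s).max' hne,
      (Finset.mem_filter.1 (Finset.max'_mem _ hne)).2, fun s' hs' => ?_⟩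
    by_contra h
    exact absurd (Finset.le_max' _ s' (Finset.mem_filter.2 ⟨Finset.mem_univ _, h⟩)) (not_le.2 hs')
  -- All indices after `s` are fixed, so injectivity leaves only smaller values for `τ s`.
  have hlt : τ s < s := by
    rcases lt_trichotomy (τ s) s with h | h | h
    · exact h
    · exact absurd h hs
    · exact absurd (τ.injective (hmax _ h)) hs
  refine columnOrder_lt_iff.2 ⟨s, I s, fun m hm l => ?_, fun l hl => ?_, ?_⟩
  · by_cases h : m ∈ Set.range I
    · obtain ⟨s', rfl⟩ := h
      rw [sum_single_apply, sum_single_apply, hmax s' (I.lt_iff_lt.1 hm)]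
      rfl
    · rw [sum_single_apply_of_notMem _ _ _ h, sum_single_apply_of_notMem _ _ _ h]
  · rw [sum_single_apply, sum_single_apply, if_neg (hlt.trans hl).ne, if_neg]
    exact hl.ne
  · rw [sum_single_apply, sum_single_apply, if_neg hlt.ne]
    simp

/-- The leading monomial of a minor is the product of the diagonal entries. -/
theorem monic_minor (I : Fin r ↪o ι) :
    (columnOrder (Fin r) ι).Monic
      ((pluckerVector (Matrix.of fun i j => (X (i, j) : MvPolynomial (Fin r × ι) K))) I) ∧
    (columnOrder (Fin r) ι).degree
      ((pluckerVector (Matrix.of fun i j => (X (i, j) : MvPolynomial (Fin r × ι) K))) I) =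
      ∑ s, Finsupp.single (s, I s) 1 := by
  classical
  set f := (pluckerVector (Matrix.of fun i j => (X (i, j) : MvPolynomial (Fin r × ι) K))) I with hf
  have hc : coeff (∑ s, Finsupp.single (s, I s) 1) f = 1 := by
    rw [hf, minor_eq_sum, coeff_sum, Finset.sum_eq_single 1]
    · simp
    · intro τ _ hτ
      rw [coeff_monomial, if_neg]
      intro h
      exact (sum_single_lt hτ I).ne (congrArg _ h)
    · simp
  have hd : (columnOrder (Fin r) ι).degree f = ∑ s, Finsupp.single (s, I s) 1 := by
    apply (columnOrder (Fin r) ι).toSyn.injective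
    refine le_antisymm ?_ ?_
    · rw [MonomialOrder.degree_le_iff]
      intro μ hμ
      rw [hf, minor_eq_sum, mem_support_iff, coeff_sum] at hμ
      obtain ⟨τ, -, h⟩ := Finset.exists_ne_zero_of_sum_ne_zero hμ
      rw [coeff_monomial] at h
      have h : ∑ s, Finsupp.single (τ s, I s) 1 = μ := by
        by_contra h'
        exact h (if_neg h')
      rw [← h]
      by_cases hτ : τ = 1
      · rw [hτ]; exact le_rfl
      · exact (sum_single_lt hτ I).le
    · refine MonomialOrder.le_degree (mem_support_iff.2 ?_)
      rw [hc]
      exact one_ne_zero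
  exact ⟨by rw [MonomialOrder.Monic, MonomialOrder.leadingCoeff, hd, hc], hd⟩

/-- An exponent that satisfies the ballot inequalities is the leading exponent of a product of
minors. -/
theorem exists_monic_substMinors (D : ℕ) : ∀ (μ : Fin r × ι →₀ ℕ), (∀ s, ∑ m, μ (s, m) = D) →
    (∀ i j, i < j → ∀ c, ∑ m with c ≤ m, μ (i, m) ≤ ∑ m with c < m, μ (j, m)) →
    ∃ F : MvPolynomial (Fin r ↪o ι) K, F.IsHomogeneous D ∧
      (columnOrder (Fin r) ι).Monic (substMinors F) ∧
      (columnOrder (Fin r) ι).degree (substMinors F) = μ := by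
  classical
  induction D with
  | zero =>
    intro μ hμ _
    refine ⟨1, isHomogeneous_one _ _, by simp [substMinors, MonomialOrder.monic_one], ?_⟩
    have : μ = 0 := by
      ext ⟨s, m⟩
      exact Finset.sum_eq_zero_iff.1 (hμ s) m (Finset.mem_univ m)
    simp [substMinors, this]
  | succ D ih =>
    intro μ hμ hb
    have hne : ∀ s, (Finset.univ.filter fun m => μ (s, m) ≠ 0).Nonempty := by
      intro s
      by_contra h
      rw [Finset.not_nonempty_iff_eq_empty, Finset.filter_eq_empty_iff] at h
      have := hμ s
      rw [Finset.sum_eq_zero fun m _ => not_not.1 (h (Finset.mem_univ m))] at this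
      omega
    -- The last columns occurring in the rows form one column of the tableau. The ballot inequality
    -- at `c = J i` makes `J` strictly increasing, so it names a minor to split off.
    choose J hJ using fun s => show ∃ m, μ (s, m) ≠ 0 ∧ ∀ m', m < m' → μ (s, m') = 0 from
      ⟨(Finset.univ.filter fun m => μ (s, m) ≠ 0).max' (hne s),
        (Finset.mem_filter.1 (Finset.max'_mem _ (hne s))).2, fun m' hm' => by
          by_contra h
          exact absurd (Finset.le_max' _ m' (Finset.mem_filter.2 ⟨Finset.mem_univ _, h⟩))
            (not_le.2 hm')⟩
    have hmono : StrictMono J := by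
      intro i j hij
      by_contra h
      rw [not_lt] at h
      have h1 := hb i j hij (J i)
      rw [Finset.sum_eq_zero (s := Finset.univ.filter (J i < ·))
        (fun m hm => (hJ j).2 m (lt_of_le_of_lt h (Finset.mem_filter.1 hm).2))] at h1
      exact (hJ i).1 (Finset.sum_eq_zero_iff.1 (Nat.le_zero.1 h1) (J i) (by simp))
    let I : Fin r ↪o ι := OrderEmbedding.ofStrictMono J hmono
    have hI : ∀ s, I s = J s := fun s => rfl
    let ε : Fin r × ι →₀ ℕ := ∑ s, Finsupp.single (s, I s) 1
    have hε : ∀ s m, ε (s, m) = if m = J s then 1 else 0 := by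
      intro s m
      simp only [ε, Finsupp.finsetSum_apply, Finsupp.single_apply, Prod.mk.injEq, hI]
      rw [Finset.sum_eq_single s]
      · simp [eq_comm]
      · intro s' _ hs'
        simp [hs']
      · simp
    have hle : ε ≤ μ := by
      rintro ⟨s, m⟩
      rw [hε]
      split_ifs with h
      · rw [h]; exact Nat.one_le_iff_ne_zero.2 (hJ s).1
      · exact Nat.zero_le _
    obtain ⟨μ', hμ'⟩ : ∃ μ', μ = μ' + ε := ⟨μ - ε, (tsub_add_cancel_of_le hle).symm⟩
    have hval : ∀ s m, μ (s, m) = μ' (s, m) + if m = J s then 1 else 0 := by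
      intro s m
      rw [hμ', Finsupp.add_apply, hε]
    obtain ⟨F, hF1, hF2, hF3⟩ := ih μ' (fun s => by
      have := hμ s
      simp_rw [hval, Finset.sum_add_distrib] at this
      simpa using this) (fun i j hij c => by
      have h1 := hb i j hij c
      -- For `c ≤ J i < J j` both sides drop by one; for `c` beyond `J i` the left side is zero.
      by_cases hc : c ≤ J i
      · simp_rw [hval, Finset.sum_add_distrib, Finset.sum_ite_eq', Finset.mem_filter,
          Finset.mem_univ, true_and, if_pos hc, if_pos (lt_of_le_of_lt hc (hmono hij))] at h1
        omega
      · refine le_of_eq_of_le ?_ (Nat.zero_le _)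
        refine Finset.sum_eq_zero fun m hm => ?_
        have := (hJ i).2 m (lt_of_lt_of_le (not_le.1 hc) (Finset.mem_filter.1 hm).2)
        rw [hval] at this
        omega)
    refine ⟨F * X I, hF1.mul (isHomogeneous_X _ _), ?_⟩
    have hX : substMinors (F * X I) = substMinors F *
        (pluckerVector (Matrix.of fun i j => (X (i, j) : MvPolynomial (Fin r × ι) K))) I := by
      simp [substMinors]
    rw [hX]
    refine ⟨hF2.mul (monic_minor I).1, ?_⟩
    rw [MonomialOrder.degree_mul hF2.ne_zero (monic_minor I).1.ne_zero, hF3, (monic_minor I).2, hμ']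

/-- The first fundamental theorem: a polynomial in the entries of a matrix that is invariant under
the unipotent row operations and homogeneous of the same degree in all rows is a polynomial in the
maximal minors. -/
theorem exists_substMinors_eq {f : MvPolynomial (Fin r × ι) K} {D : ℕ}
    (hs : ∀ i j, i < j → RowShiftInvariant i j f) (hr : ∀ s, RowHomogeneous s f D) :
    ∃ F : MvPolynomial (Fin r ↪o ι) K, F.IsHomogeneous D ∧ substMinors F = f := by
  classical
  obtain ⟨a, ha⟩ : ∃ a, a = (columnOrder (Fin r) ι).toSyn ((columnOrder (Fin r) ι).degree f) :=
    ⟨_, rfl⟩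
  induction a using WellFoundedLT.induction generalizing f with
  | ind a ih =>
    by_cases f0 : f = 0
    · exact ⟨0, isHomogeneous_zero _ _ _, by rw [f0, substMinors, map_zero]⟩
    have hmem := MonomialOrder.degree_mem_support (m := columnOrder (Fin r) ι) f0
    obtain ⟨F, hF1, hF2, hF3⟩ := exists_monic_substMinors (K := K) D
      ((columnOrder (Fin r) ι).degree f) (fun s => hr s _ hmem)
      (fun i j hij c => (hs i j hij).sum_le_sum hij (hr i) (hr j) c)
    -- Subtracting cancels the leading term and keeps invariance and row degrees, so the
    -- well-founded induction continues.
    set g := f - C ((columnOrder (Fin r) ι).leadingCoeff f) * substMinors F with hg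
    have hgC : g = f - substMinors (C ((columnOrder (Fin r) ι).leadingCoeff f) * F) := by
      rw [hg, substMinors, substMinors, map_mul, algHom_C, algebraMap_eq]
    have hH : (C ((columnOrder (Fin r) ι).leadingCoeff f) * F).IsHomogeneous D := hF1.C_mul _
    by_cases g0 : g = 0
    · exact ⟨_, hH, (sub_eq_zero.1 (hgC.symm.trans g0)).symm⟩
    have hlt : (columnOrder (Fin r) ι).degree g ≺[columnOrder (Fin r) ι]
        (columnOrder (Fin r) ι).degree f := by
      refine lt_of_le_of_ne ?_ ?_
      · refine MonomialOrder.degree_sub_le.trans (sup_le le_rfl ?_)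
        refine MonomialOrder.degree_mul_le.trans ?_
        rw [MonomialOrder.degree_C, zero_add, hF3]
      · intro h
        have h := (columnOrder (Fin r) ι).toSyn.injective h
        have h1 := MonomialOrder.degree_mem_support (m := columnOrder (Fin r) ι) g0
        rw [h, mem_support_iff, hg, coeff_sub, coeff_C_mul, ← hF3, hF2.coeff_degree, hF3] at h1
        exact h1 (by rw [MonomialOrder.leadingCoeff, mul_one, sub_self])
    have hgs : ∀ i j, i < j → RowShiftInvariant i j g := by
      intro i j hij
      have h1 := hs i j hij
      have h2 := rowShiftInvariant_substMinors hij.ne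
        (C ((columnOrder (Fin r) ι).leadingCoeff f) * F)
      rw [RowShiftInvariant] at *
      rw [hgC, map_sub, h1, h2, map_sub]
    have hgr : ∀ s, RowHomogeneous s g D := by
      intro s
      rw [hgC, rowHomogeneous_iff]
      exact (rowHomogeneous_iff.1 (hr s)).sub (rowHomogeneous_iff.1 (rowHomogeneous_substMinors s hH))
    obtain ⟨G, hG1, hG2⟩ := ih _ (ha ▸ hlt) hgs hgr rfl
    refine ⟨G + C ((columnOrder (Fin r) ι).leadingCoeff f) * F, hG1.add hH, ?_⟩
    have : substMinors (G + C ((columnOrder (Fin r) ι).leadingCoeff f) * F) =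
      substMinors G + substMinors (C ((columnOrder (Fin r) ι).leadingCoeff f) * F) := map_add _ _ _
    rw [this, hG2, hgC, sub_add_cancel]

end Brackets

/-! ### Forms and their coefficient vectors. -/

section Forms

theorem coeff_form {L : Type*} [CommRing L] {k d : ℕ} (c : Mon k d → L) (m : Mon k d) :
    coeff m.1 (form c) = c m := by
  classical
  rw [form, coeff_sum, Finset.sum_eq_single m]
  · simp
  · intro m' _ h
    rw [coeff_monomial, if_neg]
    exact fun h' => h (Subtype.ext h')
  · simp

theorem form_isHomogeneous {L : Type*} [CommRing L] {k d : ℕ} (c : Mon k d → L) :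
    (form c).IsHomogeneous d :=
  IsHomogeneous.sum _ _ _ fun m _ => isHomogeneous_monomial _ m.2

theorem form_coeff {L : Type*} [CommRing L] {k d : ℕ} {g : MvPolynomial (Fin (k + 1)) L}
    (hg : g.IsHomogeneous d) : form (fun m : Mon k d => coeff m.1 g) = g := by
  ext γ
  by_cases h : γ.degree = d
  · exact coeff_form (fun m : Mon k d => coeff m.1 g) ⟨γ, h⟩
  · rw [hg.coeff_eq_zero h, (form_isHomogeneous _).coeff_eq_zero h]

theorem eval_form {L : Type*} [CommRing L] {k d : ℕ} (c : Mon k d → L) (x : Fin (k + 1) → L) :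
    eval x (form c) = ∑ m, c m * monomials k d x m := by
  rw [form, map_sum]
  refine Finset.sum_congr rfl fun m _ => ?_
  rw [eval_monomial, Finsupp.prod_fintype _ _ (by simp)]
  rfl

theorem map_form {L L' : Type*} [CommRing L] [CommRing L'] (φ : L →+* L') {k d : ℕ}
    (c : Mon k d → L) : map φ (form c) = form fun m => φ (c m) := by
  simp [form, map_monomial]

/-- A polynomial in finitely many variables over `K` that vanishes at all points over an infinite
extension field is zero. -/
theorem eq_zero_of_forall_aeval_eq_zero {K L τ : Type*} [Field K] [Field L] [Algebra K L]
    [Infinite L] {p : MvPolynomial τ K} (h : ∀ z : τ → L, aeval z p = 0) : p = 0 := by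
  apply map_injective (algebraMap K L) (algebraMap K L).injective
  rw [map_zero]
  refine MvPolynomial.funext fun z => ?_
  rw [eval_map, ← aeval_def, h, map_zero]

end Forms

/-! ### Eliminants from Macaulay matrices. -/

section Elimination

/-- A matrix with a right inverse has a maximal minor that does not vanish. -/
theorem exists_det_submatrix_ne_zero {L m n : Type*} [Field L] [Fintype m] [DecidableEq m]
    [Fintype n] {T : Matrix m n L} {Y : Matrix n m L} (h : T * Y = 1) :
    ∃ e : m → n, (T.submatrix id e).det ≠ 0 := by
  classical
  by_contra! h0
  have h1 : (T * Y).transpose.det = 0 := by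
    -- The columns of `T * Y` are combinations of those of `T`; multilinearity expands the
    -- determinant in minors of `T`, where `e` may repeat columns.
    have : (T * Y).transpose = fun a => ∑ q, Y q a • fun b => T b q := by
      funext a b
      simp [Matrix.transpose_apply, Matrix.mul_apply, mul_comm]
    rw [this]
    change Matrix.detRowAlternating.toMultilinearMap (fun a => ∑ q, Y q a • fun b => T b q) = 0
    rw [MultilinearMap.map_sum]
    refine Finset.sum_eq_zero fun e _ => ?_
    rw [MultilinearMap.map_smul_univ]
    have h2 := h0 e
    rw [← Matrix.det_transpose] at h2
    change _ • (T.submatrix id e).transpose.det = 0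
    rw [h2, smul_zero]
  rw [Matrix.det_transpose, h, Matrix.det_one] at h1
  exact one_ne_zero h1

/-- The Macaulay matrix of a system of forms in degree `s + d`. -/
def macaulay {B : Type*} [CommRing B] {k d r : ℕ} (s : ℕ) (c : Fin r → Mon k d → B) :
    Matrix (Mon k (s + d)) (Fin r × Mon k s) B :=
  fun α q => coeff α.1 (monomial q.2.1 1 * form (c q.1))

theorem macaulay_map {B B' : Type*} [CommRing B] [CommRing B'] (φ : B →+* B') {k d r : ℕ} (s : ℕ)
    (c : Fin r → Mon k d → B) : (macaulay s c).map φ = macaulay s fun i m => φ (c i m) := by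
  ext α q
  simp only [macaulay, Matrix.map_apply]
  rw [← coeff_map, map_mul, map_form, map_monomial, map_one]

/-- A nontrivial common zero thus gives a nonzero left kernel vector, which kills all maximal
minors. -/
theorem vecMul_macaulay {B : Type*} [CommRing B] {k d r : ℕ} (s : ℕ) (c : Fin r → Mon k d → B)
    {x : Fin (k + 1) → B} (hx : ∀ i, eval x (form (c i)) = 0) (q : Fin r × Mon k s) :
    Matrix.vecMul (monomials k (s + d) x) (macaulay s c) q = 0 := by
  have h1 : (monomial q.2.1 1 * form (c q.1)).IsHomogeneous (s + d) :=
    (isHomogeneous_monomial _ q.2.2).mul (form_isHomogeneous _)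
  have h2 : eval x (monomial q.2.1 1 * form (c q.1)) = 0 := by rw [map_mul, hx, mul_zero]
  rw [← form_coeff h1, eval_form] at h2
  rw [← h2]
  exact Finset.sum_congr rfl fun α _ => mul_comm _ _

/-- The `g i` need not be homogeneous: only their parts of degree `s` contribute in degree `s + d`.
-/
theorem macaulay_mul {B : Type*} [CommRing B] {k d r : ℕ} (s : ℕ) (c : Fin r → Mon k d → B)
    (g : Fin r → MvPolynomial (Fin (k + 1)) B) (α : Mon k (s + d)) :
    ∑ q : Fin r × Mon k s, macaulay s c α q * coeff q.2.1 (g q.1) =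
      coeff α.1 (∑ i, g i * form (c i)) := by
  classical
  rw [Fintype.sum_prod_type, coeff_sum]
  refine Finset.sum_congr rfl fun i _ => ?_
  have h1 : ∑ β : Mon k s, macaulay s c α (i, β) * coeff β.1 (g i) =
      coeff α.1 (form (fun β : Mon k s => coeff β.1 (g i)) * form (c i)) := by
    rw [form, Finset.sum_mul, coeff_sum]
    refine Finset.sum_congr rfl fun β _ => ?_
    rw [macaulay, mul_comm, ← coeff_C_mul, ← mul_assoc, C_mul_monomial, mul_one]
  rw [h1]
  conv_lhs => enter [2, 2]; rw [form]
  conv_rhs => enter [2, 2]; rw [form]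
  rw [Finset.mul_sum, Finset.mul_sum, coeff_sum, coeff_sum]
  refine Finset.sum_congr rfl fun m _ => ?_
  rw [coeff_mul_monomial', coeff_mul_monomial']
  split_ifs with h
  · congr 1
    have hdeg : (α.1 - m.1).degree = s := by
      have h2 : (α.1 - m.1).degree + m.1.degree = α.1.degree := by
        rw [← map_add, tsub_add_cancel_of_le h]
      rw [m.2, α.2] at h2
      omega
    exact coeff_form (fun β : Mon k s => coeff β.1 (g i)) ⟨_, hdeg⟩
  · rfl

/-- The main theorem of elimination theory: a system of forms without non-trivial common zeros is
separated by a polynomial in the coefficients from all systems with a non-trivial common zero. -/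
theorem exists_eliminant (K : Type*) {L : Type*} [Field K] [Field L] [IsAlgClosed L] [Algebra K L]
    {k d r : ℕ} (c : Fin r → Mon k d → L)
    (hc : ¬ ∃ x : Fin (k + 1) → L, x ≠ 0 ∧ ∀ i, eval x (form (c i)) = 0) :
    ∃ G : MvPolynomial (Fin r × Mon k d) K, aeval (fun q => c q.1 q.2) G ≠ 0 ∧
      ∀ c' : Fin r → Mon k d → L, (∃ x : Fin (k + 1) → L, x ≠ 0 ∧
        ∀ i, eval x (form (c' i)) = 0) → aeval (fun q => c' q.1 q.2) G = 0 := by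
  classical
  let I : Ideal (MvPolynomial (Fin (k + 1)) L) := Ideal.span (Set.range fun i => form (c i))
  let J : Ideal (MvPolynomial (Fin (k + 1)) L) := Ideal.span (Set.range X)
  have hJ : J ≤ I.radical := by
    rw [← vanishingIdeal_zeroLocus_eq_radical (K := L)]
    refine Ideal.span_le.2 ?_
    rintro _ ⟨j, rfl⟩
    rw [SetLike.mem_coe, mem_vanishingIdeal_iff]
    intro x hx
    rw [mem_zeroLocus_iff] at hx
    have : x = 0 := by
      by_contra h0
      refine hc ⟨x, h0, fun i => ?_⟩
      exact hx _ (Ideal.subset_span ⟨i, rfl⟩)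
    rw [this]
    simp
  -- By the Nullstellensatz a power of the irrelevant ideal lies in `I`. Degree `s + d` leaves
  -- multipliers of degree `s`; every monomial of that degree lies in `I`, so the Macaulay matrix
  -- has a right inverse.
  obtain ⟨s, hs⟩ := Ideal.exists_pow_le_of_le_radical_of_fg hJ
    ⟨Finset.univ.image X, by simp [J]⟩
  have hs' : J ^ (s + d) ≤ I := (Ideal.pow_le_pow_right (Nat.le_add_right s d)).trans hs
  have hmem : ∀ α : Mon k (s + d), ∃ g : Fin r → MvPolynomial (Fin (k + 1)) L,
      ∑ i, g i * form (c i) = monomial α.1 1 := by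
    intro α
    have : (monomial α.1 1 : MvPolynomial (Fin (k + 1)) L) ∈ I := by
      apply hs'
      have hsum : ∑ i, α.1 i = s + d := by rw [← Finsupp.degree_eq_sum]; exact α.2
      have h1 := Finset.prod_pow_eq_pow_sum Finset.univ (fun i => α.1 i) J
      rw [hsum] at h1
      rw [← h1, ← monomial_eq_prod_X_pow]
      exact Ideal.prod_mem_prod fun i _ => Ideal.pow_mem_pow (Ideal.subset_span (Set.mem_range_self i)) _
    exact (Ideal.mem_span_range_iff_exists_fun).1 this
  choose g hg using hmem
  have hTY : macaulay s c * (Matrix.of fun (q : Fin r × Mon k s) α => coeff q.2.1 (g α q.1)) = 1 := by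
    ext α' α
    rw [Matrix.mul_apply]
    simp only [Matrix.of_apply]
    rw [macaulay_mul, hg, coeff_monomial, Matrix.one_apply]
    exact if_congr ⟨fun h => Subtype.ext h.symm, fun h => by rw [h]⟩ rfl rfl
  obtain ⟨e, he⟩ := exists_det_submatrix_ne_zero hTY
  let T : Matrix (Mon k (s + d)) (Fin r × Mon k s) (MvPolynomial (Fin r × Mon k d) K) :=
    macaulay s fun i m => X (i, m)
  have hT : ∀ c' : Fin r → Mon k d → L, aeval (fun q => c' q.1 q.2) (T.submatrix id e).det =
      ((macaulay s c').submatrix id e).det := by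
    intro c'
    rw [← AlgHom.coe_toRingHom, RingHom.map_det]
    congr 1
    have := macaulay_map (aeval (fun q : Fin r × Mon k d => c' q.1 q.2) :
      MvPolynomial (Fin r × Mon k d) K →ₐ[K] L).toRingHom s (fun i m => X (i, m))
    simp only [AlgHom.toRingHom_eq_coe, RingHom.coe_coe, aeval_X] at this
    rw [← this]
    rfl
  refine ⟨(T.submatrix id e).det, by rwa [hT], ?_⟩
  rintro c' ⟨x, hx0, hx⟩
  rw [hT]
  refine Matrix.exists_vecMul_eq_zero_iff.1 ⟨monomials k (s + d) x, monomials_ne_zero k _ hx0, ?_⟩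
  funext α
  exact vecMul_macaulay s c' hx (e α)

end Elimination

/-! ### A criterion for a prime ideal to be principal. -/

section Principal

/-- A nonzero prime ideal of `A[X]` that contains no nonzero constant is principal. -/
theorem exists_prime_span_eq_of_comap_C {A : Type*} [CommRing A] [IsDomain A]
    [UniqueFactorizationMonoid A] {Q : Ideal (Polynomial A)} [hQ : Q.IsPrime] (h0 : Q ≠ ⊥)
    (hC : ∀ a : A, Polynomial.C a ∈ Q → a = 0) : ∃ R, Prime R ∧ Q = Ideal.span {R} := by
  classical
  have : NormalizedGCDMonoid A := Nonempty.some inferInstance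
  obtain ⟨R, hR, hp⟩ := Ideal.IsPrime.exists_mem_prime_of_ne_bot hQ h0
  refine ⟨R, hp, le_antisymm (fun G hG => Ideal.mem_span_singleton.2 ?_)
    ((Ideal.span_singleton_le_iff_mem _).2 hR)⟩
  have hdeg : R.natDegree ≠ 0 := by
    intro h
    rw [Polynomial.eq_C_of_natDegree_eq_zero h] at hR hp
    rw [hC _ hR, map_zero] at hp
    exact hp.ne_zero rfl
  have hprim := hp.irreducible.isPrimitive hdeg
  have hirr := (hprim.irreducible_iff_irreducible_map_fraction_map (K := FractionRing A)).1
    hp.irreducible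
  by_cases hdvd : R.map (algebraMap A (FractionRing A)) ∣ G.map (algebraMap A (FractionRing A))
  · exact hprim.dvd_of_fraction_map_dvd_fraction_map hdvd
  exfalso
  -- A Bézout relation over the fraction field, cleared of denominators, puts the nonzero constant
  -- `a * b` into `Q`.
  obtain ⟨u, v, huv⟩ := (hirr.coprime_iff_not_dvd).2 hdvd
  obtain ⟨a, ha, hu⟩ := IsLocalization.integerNormalization_spec (nonZeroDivisors A) u
  obtain ⟨b, hb, hv⟩ := IsLocalization.integerNormalization_spec (nonZeroDivisors A) v
  rw [Algebra.smul_def, Polynomial.algebraMap_apply] at hu hv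
  have key : Polynomial.C (a * b) = Polynomial.C b * IsLocalization.integerNormalization (nonZeroDivisors A) u * R +
      Polynomial.C a * IsLocalization.integerNormalization (nonZeroDivisors A) v * G := by
    apply Polynomial.map_injective (algebraMap A (FractionRing A)) (IsFractionRing.injective _ _)
    simp only [Polynomial.map_add, Polynomial.map_mul, hu, hv, Polynomial.map_C, map_mul]
    linear_combination (-(Polynomial.C (algebraMap A (FractionRing A) a)) *
      Polynomial.C (algebraMap A (FractionRing A) b)) * huv
  have : Polynomial.C (a * b) ∈ Q := by
    rw [key]
    exact Q.add_mem (Q.mul_mem_left _ hR) (Q.mul_mem_left _ hG)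
  have := hC _ this
  exact mul_ne_zero (nonZeroDivisors.ne_zero ha) (nonZeroDivisors.ne_zero hb) this

/-- A nonzero prime ideal of a polynomial ring, all of whose nonzero elements involve a fixed
variable, is principal. -/
theorem exists_prime_span_eq_of_rename {K σ : Type*} [Field K] (q₀ : σ)
    {P : Ideal (MvPolynomial σ K)} [hP : P.IsPrime] (h0 : P ≠ ⊥)
    (hC : ∀ H : MvPolynomial {q // q ≠ q₀} K, rename Subtype.val H ∈ P → H = 0) :
    ∃ R, Prime R ∧ P = Ideal.span {R} := by
  classical
  let e : MvPolynomial σ K ≃ₐ[K] Polynomial (MvPolynomial {q // q ≠ q₀} K) :=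
    (renameEquiv K (Equiv.optionSubtypeNe q₀).symm).trans (optionEquivLeft K _)
  have he : ∀ H : MvPolynomial {q // q ≠ q₀} K, e.symm (Polynomial.C H) = rename Subtype.val H := by
    intro H
    rw [AlgEquiv.symm_apply_eq]
    simp only [e, AlgEquiv.trans_apply, renameEquiv_apply, rename_rename]
    have : (Equiv.optionSubtypeNe q₀).symm ∘ Subtype.val = (some : {q // q ≠ q₀} → _) := by
      funext q
      simp [q.2]
    rw [this]
    induction H using MvPolynomial.induction_on with
    | C a => simp
    | add p q hp hq => rw [map_add, map_add, map_add, hp, hq]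
    | mul_X p q hp => rw [map_mul, map_mul, map_mul, hp]; simp
  let Q : Ideal (Polynomial (MvPolynomial {q // q ≠ q₀} K)) := P.comap e.symm
  have hQ : Q.IsPrime := Ideal.IsPrime.comap _
  have hQ0 : Q ≠ ⊥ := by
    intro h
    apply h0
    rw [eq_bot_iff]
    intro G hG
    have : e G ∈ Q := by
      rw [Ideal.mem_comap, AlgEquiv.symm_apply_apply]
      exact hG
    rw [h, Ideal.mem_bot, EmbeddingLike.map_eq_zero_iff] at this
    exact this
  obtain ⟨R, hR, hQR⟩ := exists_prime_span_eq_of_comap_C hQ0 (fun a ha => hC a (by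
    rw [← he]; exact ha))
  refine ⟨e.symm R, (MulEquiv.prime_iff e.symm).2 hR, ?_⟩
  ext G
  have h1 : G ∈ P ↔ e G ∈ Q := by rw [Ideal.mem_comap, AlgEquiv.symm_apply_apply]
  rw [h1, hQR, Ideal.mem_span_singleton, Ideal.mem_span_singleton]
  rw [← map_dvd_iff e.symm, AlgEquiv.symm_apply_apply]

end Principal

/-! ### The ideal of solvable systems is prime and nonzero. -/

section Parametrization

variable {k d : ℕ}

/-- The systems of `k + 1` forms of degree `d` with a non-trivial common zero. -/
def solvableSystems (L : Type*) [Field L] (k d : ℕ) : Set (Fin (k + 1) × Mon k d → L) :=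
  {c | ∃ x : Fin (k + 1) → L, x ≠ 0 ∧ ∀ i, eval x (form fun m => c (i, m)) = 0}

/-- The exponent of `x_j ^ d`. -/
def pureMon (k d : ℕ) (j : Fin (k + 1)) : Mon k d := ⟨Finsupp.single j d, Finsupp.degree_single j d⟩

theorem monomials_pureMon {B : Type*} [CommRing B] (x : Fin (k + 1) → B) (j : Fin (k + 1)) :
    monomials k d x (pureMon k d j) = x j ^ d := by
  rw [monomials, Finset.prod_eq_single j]
  · simp [pureMon]
  · intro l _ hl
    simp [pureMon, hl.symm]
  · simp

/-- A system of forms that vanish at `x`, parametrized by arbitrary coefficients `b`: the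
coefficients of `x_j ^ d` are corrected. -/
def parametrize {B : Type*} [CommRing B] (j : Fin (k + 1)) (x : Fin (k + 1) → B)
    (b : Fin (k + 1) × Mon k d → B) : Fin (k + 1) × Mon k d → B := fun q =>
  x j ^ d * b q - if q.2 = pureMon k d j then ∑ m, b (q.1, m) * monomials k d x m else 0

theorem map_parametrize {B B' : Type*} [CommRing B] [CommRing B'] (φ : B →+* B')
    (j : Fin (k + 1)) (x : Fin (k + 1) → B) (b : Fin (k + 1) × Mon k d → B)
    (q : Fin (k + 1) × Mon k d) :
    φ (parametrize j x b q) = parametrize j (fun l => φ (x l)) (fun q => φ (b q)) q := by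
  simp only [parametrize, map_sub, map_mul, map_pow]
  split_ifs
  · simp [monomials]
  · simp

theorem eval_form_parametrize {B : Type*} [CommRing B] (j : Fin (k + 1)) (x : Fin (k + 1) → B)
    (b : Fin (k + 1) × Mon k d → B) (i : Fin (k + 1)) :
    eval x (form fun m => parametrize j x b (i, m)) = 0 := by
  simp only [eval_form, parametrize, sub_mul, Finset.sum_sub_distrib, ite_mul, zero_mul,
    Finset.sum_ite_eq', Finset.mem_univ, if_true, monomials_pureMon]
  rw [sub_eq_zero, Finset.sum_mul]
  exact Finset.sum_congr rfl fun m _ => by ring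

/-- The correction term vanishes for a system that already vanishes at `x`, so the parametrization
reaches every system with a zero where `x j ≠ 0`. -/
theorem parametrize_div {L : Type*} [Field L] {j : Fin (k + 1)} {x : Fin (k + 1) → L}
    (hx : x j ≠ 0) {c : Fin (k + 1) × Mon k d → L}
    (hc : ∀ i, eval x (form fun m => c (i, m)) = 0) :
    parametrize j x (fun q => c q / x j ^ d) = c := by
  funext q
  have h1 : ∑ m, c (q.1, m) / x j ^ d * monomials k d x m = 0 := by
    have := hc q.1
    rw [eval_form] at this
    simp_rw [div_mul_eq_mul_div]
    rw [← Finset.sum_div, this, zero_div]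
  simp only [parametrize, h1, ite_self, sub_zero]
  exact mul_div_cancel₀ _ (pow_ne_zero _ hx)

variable {K L : Type*} [Field K] [Field L] [Algebra K L]

/-- At `x = 0` the parametrized system is zero because `d > 0`, hence still solvable. -/
theorem parametrize_mem_solvableSystems (hd : 0 < d) (j : Fin (k + 1)) (x : Fin (k + 1) → L)
    (b : Fin (k + 1) × Mon k d → L) : parametrize j x b ∈ solvableSystems L k d := by
  by_cases hx : x = 0
  · refine ⟨fun _ => 1, fun h => one_ne_zero (congrFun h 0), fun i => ?_⟩
    have h0 : monomials k d x = 0 := by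
      funext m
      have hm : ∑ i, m.1 i ≠ 0 := by rw [← Finsupp.degree_eq_sum, m.2]; exact hd.ne'
      obtain ⟨l, -, hl⟩ := Finset.exists_ne_zero_of_sum_ne_zero hm
      refine Finset.prod_eq_zero (Finset.mem_univ l) ?_
      rw [hx, Pi.zero_apply, zero_pow hl]
    have : (fun m => parametrize j x b (i, m)) = fun _ => (0 : L) := by
      funext m
      simp only [parametrize, h0, Pi.zero_apply, mul_zero, Finset.sum_const_zero, ite_self]
      rw [hx, Pi.zero_apply, zero_pow hd.ne', zero_mul, sub_zero]
    rw [this, eval_form]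
    simp
  · exact ⟨x, hx, eval_form_parametrize j x b⟩

theorem aeval_aeval_parametrize {B : Type*} [CommRing B] [Algebra K B] (j : Fin (k + 1))
    (G : MvPolynomial (Fin (k + 1) × Mon k d) K)
    (z : Fin (k + 1) ⊕ (Fin (k + 1) × Mon k d) → B) :
    aeval z (aeval (parametrize j (fun l => X (Sum.inl l)) (fun q => X (Sum.inr q))) G :
      MvPolynomial (Fin (k + 1) ⊕ (Fin (k + 1) × Mon k d)) K) =
      aeval (parametrize j (fun l => z (Sum.inl l)) (fun q => z (Sum.inr q))) G := by
  rw [comp_aeval_apply]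
  congr 2
  funext q
  have := map_parametrize (aeval z : MvPolynomial (Fin (k + 1) ⊕ (Fin (k + 1) × Mon k d)) K →ₐ[K] B).toRingHom
    j (fun l => X (Sum.inl l)) (fun q => X (Sum.inr q)) q
  simpa using this

theorem aeval_parametrize_eq_zero [Infinite L] (hd : 0 < d)
    {G : MvPolynomial (Fin (k + 1) × Mon k d) K}
    (hG : G ∈ vanishingIdeal K (solvableSystems L k d)) (j : Fin (k + 1)) :
    aeval (parametrize j (fun l => X (Sum.inl l)) (fun q => X (Sum.inr q)) : _ →
      MvPolynomial (Fin (k + 1) ⊕ (Fin (k + 1) × Mon k d)) K) G = 0 := by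
  refine eq_zero_of_forall_aeval_eq_zero (L := L) fun z => ?_
  rw [aeval_aeval_parametrize]
  exact mem_vanishingIdeal_iff.1 hG _ (parametrize_mem_solvableSystems hd _ _ _)

/-- One chart suffices: by irreducibility of the parameter space, vanishing where `x j ≠ 0` carries
over to all charts. -/
theorem mem_vanishingIdeal_solvableSystems_iff [Infinite L] (hd : 0 < d)
    {G : MvPolynomial (Fin (k + 1) × Mon k d) K} (j : Fin (k + 1)) :
    G ∈ vanishingIdeal K (solvableSystems L k d) ↔
    aeval (parametrize j (fun l => X (Sum.inl l)) (fun q => X (Sum.inr q)) : _ →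
      MvPolynomial (Fin (k + 1) ⊕ (Fin (k + 1) × Mon k d)) K) G = 0 := by
  refine ⟨fun hG => aeval_parametrize_eq_zero hd hG j, fun hG => ?_⟩
  have hj : ∀ c x, x j ≠ 0 → (∀ i, eval x (form fun m => c (i, m)) = 0) →
      (aeval c G : L) = 0 := by
    intro c x hx hc
    have := aeval_aeval_parametrize j G (Sum.elim x (fun q => c q / x j ^ d))
    rw [hG, map_zero] at this
    simp only [Sum.elim_inl, Sum.elim_inr] at this
    rw [parametrize_div hx hc] at this
    exact this.symm
  have hall : ∀ l, aeval (parametrize l (fun l => X (Sum.inl l)) (fun q => X (Sum.inr q)) : _ →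
      MvPolynomial (Fin (k + 1) ⊕ (Fin (k + 1) × Mon k d)) K) G = 0 := by
    intro l
    have h1 : (X (Sum.inl j) : MvPolynomial (Fin (k + 1) ⊕ (Fin (k + 1) × Mon k d)) K) *
        aeval (parametrize l (fun l => X (Sum.inl l)) (fun q => X (Sum.inr q)) : _ →
        MvPolynomial (Fin (k + 1) ⊕ (Fin (k + 1) × Mon k d)) K) G = 0 := by
      refine eq_zero_of_forall_aeval_eq_zero (L := L) fun z => ?_
      rw [map_mul, aeval_X, aeval_aeval_parametrize]
      by_cases hz : z (Sum.inl j) = 0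
      · rw [hz, zero_mul]
      · rw [hj _ (fun l => z (Sum.inl l)) hz (eval_form_parametrize l _ _), mul_zero]
    exact (mul_eq_zero.1 h1).resolve_left (X_ne_zero _)
  rw [mem_vanishingIdeal_iff]
  rintro c ⟨x, hx0, hc⟩
  obtain ⟨l, hl⟩ := Function.ne_iff.1 hx0
  have := aeval_aeval_parametrize l G (Sum.elim x (fun q => c q / x l ^ d))
  rw [hall, map_zero] at this
  simp only [Sum.elim_inl, Sum.elim_inr] at this
  rw [parametrize_div hl hc] at this
  exact this.symm

variable (K L) in
theorem isPrime_vanishingIdeal_solvableSystems [Infinite L] (hd : 0 < d) :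
    (vanishingIdeal K (solvableSystems L k d)).IsPrime := by
  have : vanishingIdeal K (solvableSystems L k d) = RingHom.ker
      (aeval (parametrize 0 (fun l => X (Sum.inl l)) (fun q => X (Sum.inr q)) : _ →
      MvPolynomial (Fin (k + 1) ⊕ (Fin (k + 1) × Mon k d)) K) :
        MvPolynomial (Fin (k + 1) × Mon k d) K →ₐ[K] _) := by
    ext G
    rw [mem_vanishingIdeal_solvableSystems_iff hd 0, RingHom.mem_ker]
  rw [this]
  exact RingHom.ker_isPrime _

variable (K L) in
theorem vanishingIdeal_solvableSystems_ne_bot [IsAlgClosed L] (hd : 0 < d) :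
    vanishingIdeal K (solvableSystems L k d) ≠ ⊥ := by
  classical
  -- The system `x_0 ^ d, …, x_k ^ d` has no nontrivial zero.
  obtain ⟨G, hG, hG'⟩ := exists_eliminant K
    (fun (i : Fin (k + 1)) (m : Mon k d) => if m = pureMon k d i then (1 : L) else 0) (by
      rintro ⟨x, hx0, hx⟩
      apply hx0
      funext i
      have := hx i
      simp only [eval_form, ite_mul, one_mul, zero_mul, Finset.sum_ite_eq', Finset.mem_univ,
        if_true, monomials_pureMon] at this
      exact pow_eq_zero_iff hd.ne' |>.1 this)
  intro h
  have : G ∈ vanishingIdeal K (solvableSystems L k d) := by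
    rw [mem_vanishingIdeal_iff]
    intro c hc
    exact hG' (fun i m => c (i, m)) hc
  rw [h, Ideal.mem_bot] at this
  rw [this, map_zero] at hG
  exact hG rfl

end Parametrization

/-! ### Algebraic independence from leading exponents. -/

section Independence

open scoped MonomialOrder

/-- Polynomials with independent leading exponents are algebraically independent. -/
theorem eq_zero_of_aeval_eq_zero_of_injective_degree {K σ τ : Type*} [Field K] [Fintype σ]
    (mo : MonomialOrder τ) {p : σ → MvPolynomial τ K} (hp : ∀ q, p q ≠ 0)
    (hinj : Function.Injective fun μ : σ →₀ ℕ => ∑ q, μ q • mo.degree (p q))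
    {H : MvPolynomial σ K} (hH : aeval p H = 0) : H = 0 := by
  by_contra h0
  obtain ⟨μ, hμ, hmax⟩ := Finset.exists_max_image H.support
    (fun μ => mo.toSyn (∑ q, μ q • mo.degree (p q))) (support_nonempty.2 h0)
  have hne : ∀ μ : σ →₀ ℕ, ∏ q, p q ^ μ q ≠ 0 := fun μ =>
    Finset.prod_ne_zero_iff.2 fun q _ => pow_ne_zero _ (hp q)
  have hdeg : ∀ μ : σ →₀ ℕ, mo.degree (∏ q, p q ^ μ q) = ∑ q, μ q • mo.degree (p q) := by
    intro μ
    rw [MonomialOrder.degree_prod fun q _ => pow_ne_zero _ (hp q)]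
    exact Finset.sum_congr rfl fun q _ => MonomialOrder.degree_pow _ _
  have h1 := congrArg (coeff (∑ q, μ q • mo.degree (p q))) hH
  rw [aeval_def, eval₂_eq', coeff_sum, coeff_zero, Finset.sum_eq_single μ] at h1
  · rw [algebraMap_eq, coeff_C_mul, ← hdeg] at h1
    exact mul_ne_zero (mem_support_iff.1 hμ) (MonomialOrder.coeff_degree_ne_zero_iff.2 (hne μ)) h1
  · intro ν hν hνμ
    rw [algebraMap_eq, coeff_C_mul, MonomialOrder.coeff_eq_zero_of_lt (m := mo), mul_zero]
    rw [hdeg]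
    exact lt_of_le_of_ne (hmax ν hν) fun h => hνμ (hinj (mo.toSyn.injective h))
  · exact fun h => (h hμ).elim

end Independence

/-! ### The generic system vanishing at a generic point. -/

section Generic

open scoped MonomialOrder

/-- Variables for the coefficients of the `x_i ^ d`, for the `x_i`, and for the other coefficients,
in this order. -/
abbrev GenericVar (k d : ℕ) : Type :=
  Lex (Fin (k + 1) ⊕ Lex (Fin (k + 1) ⊕ Lex (Fin (k + 1) × Mon k d)))

variable {K : Type*} [Field K] {k d : ℕ}

/-- The variable for the coefficient of `x_i ^ d`. -/
def pureVar (d : ℕ) {k : ℕ} (i : Fin (k + 1)) : GenericVar k d := toLex (Sum.inl i)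

/-- The variable for `x_i`. -/
def coordVar (d : ℕ) {k : ℕ} (i : Fin (k + 1)) : GenericVar k d :=
  toLex (Sum.inr (toLex (Sum.inl i)))

/-- The variable for one of the other coefficients. -/
def otherVar (q : Fin (k + 1) × Mon k d) : GenericVar k d :=
  toLex (Sum.inr (toLex (Sum.inr (toLex q))))

theorem pureVar_injective : Function.Injective (pureVar d (k := k)) := fun _ _ h =>
  Sum.inl_injective h

theorem coordVar_injective : Function.Injective (coordVar d (k := k)) := fun _ _ h =>
  Sum.inl_injective (Sum.inr_injective h)

theorem otherVar_injective : Function.Injective (otherVar (k := k) (d := d)) := fun _ _ h =>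
  Sum.inr_injective (Sum.inr_injective h)

theorem pureVar_ne_coordVar (i l : Fin (k + 1)) : pureVar d i ≠ coordVar d l := fun h =>
  Sum.inl_ne_inr h

theorem pureVar_ne_otherVar (i : Fin (k + 1)) (q : Fin (k + 1) × Mon k d) :
    pureVar d i ≠ otherVar q := fun h => Sum.inl_ne_inr h

theorem coordVar_ne_otherVar (i : Fin (k + 1)) (q : Fin (k + 1) × Mon k d) :
    coordVar d i ≠ otherVar q := fun h => Sum.inl_ne_inr (Sum.inr_injective h)

theorem pureMon_injective (hd : 0 < d) : Function.Injective (pureMon k d) := by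
  intro i j h
  have h := Subtype.ext_iff.1 h
  by_contra hij
  have := DFunLike.congr_fun h i
  simp [pureMon, Ne.symm hij] at this
  omega

/-- The coordinates of a generic point with first coordinate `1`. -/
def genericPoint (K : Type*) [Field K] (k d : ℕ) : Fin (k + 1) → MvPolynomial (GenericVar k d) K :=
  fun l => if l = 0 then 1 else X (coordVar d l)

/-- Generic coefficients for the monomials other than `x_0 ^ d`. -/
def genericCoeff (K : Type*) [Field K] (k d : ℕ) :
    Fin (k + 1) × Mon k d → MvPolynomial (GenericVar k d) K := fun q =>
  if q.2 = pureMon k d 0 then 0 else if q.2 = pureMon k d q.1 then X (pureVar d q.1)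
  else X (otherVar q)

/-- The leading exponents of the generic system of forms that vanish at the generic point. -/
def genericExponent (k d : ℕ) (q : Fin (k + 1) × Mon k d) : GenericVar k d →₀ ℕ :=
  if q.2 = pureMon k d 0 then Finsupp.single (pureVar d q.1) 1 + Finsupp.single (coordVar d q.1) d
  else if q.2 = pureMon k d q.1 then Finsupp.single (pureVar d q.1) 1
  else Finsupp.single (otherVar q) 1

theorem lex_lt_of_pureVar_eq_zero {ν : GenericVar k d →₀ ℕ} (hν : ∀ l, ν (pureVar d l) = 0)
    (i : Fin (k + 1)) (e : ℕ) : ν ≺[MonomialOrder.lex]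
      Finsupp.single (pureVar d i) 1 + Finsupp.single (coordVar d i) e := by
  rw [MonomialOrder.lex_lt_iff, Finsupp.Lex.lt_iff]
  refine ⟨pureVar d i, fun v hv => ?_, ?_⟩
  · obtain ⟨l, rfl, hl⟩ : ∃ l, v = pureVar d l ∧ l ≠ i := by
      rcases h : ofLex v with l | w
      · have h' : v = pureVar d l := h
        refine ⟨l, h', ?_⟩
        rintro rfl
        exact hv.ne h'
      · have h' : v = toLex (Sum.inr w) := h
        rw [h'] at hv
        exact absurd hv Sum.Lex.not_inr_lt_inl
    simp [hν, (pureVar_injective (d := d)).ne hl.symm,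
      (pureVar_ne_coordVar l i).symm]
  · simp [hν, (pureVar_ne_coordVar i i).symm]

/-- For `i ≠ 0` the coefficient of `x_0 ^ d` in form `i` is forced; up to sign it is led by the
product of `pureVar d i` and `coordVar d i ^ d`, since no other term contains a pure variable and
these dominate. The remaining coefficients are single variables. -/
theorem degree_generic (hd : 0 < d) {q : Fin (k + 1) × Mon k d} (hq : q ≠ (0, pureMon k d 0)) :
    parametrize 0 (genericPoint K k d) (genericCoeff K k d) q ≠ 0 ∧
    MonomialOrder.lex.degree (parametrize 0 (genericPoint K k d) (genericCoeff K k d) q) =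
      genericExponent k d q := by
  classical
  obtain ⟨i, m⟩ := q
  by_cases hm : m = pureMon k d 0
  · subst hm
    have hi : i ≠ 0 := fun h => hq (by rw [h])
    have hpi : pureMon k d i ≠ pureMon k d 0 := (pureMon_injective hd).ne hi
    let Y : MvPolynomial (GenericVar k d) K := monomial
      (Finsupp.single (pureVar d i) 1 + Finsupp.single (coordVar d i) d) 1
    let Z : MvPolynomial (GenericVar k d) K := ∑ m ∈ Finset.univ.erase (pureMon k d i),
      genericCoeff K k d (i, m) * monomials k d (genericPoint K k d) m
    have hYZ : parametrize 0 (genericPoint K k d) (genericCoeff K k d) (i, pureMon k d 0) =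
        - (Y + Z) := by
      have hY : Y = genericCoeff K k d (i, pureMon k d i) *
          monomials k d (genericPoint K k d) (pureMon k d i) := by
        simp only [Y, genericCoeff, hpi, if_false, if_true, monomials_pureMon, genericPoint, hi]
        rw [X_pow_eq_monomial, X, monomial_mul, one_mul]
      simp only [parametrize, if_true]
      rw [hY, Finset.add_sum_erase _ (fun m => genericCoeff K k d (i, m) *
        monomials k d (genericPoint K k d) m) (Finset.mem_univ _)]
      simp [genericCoeff]
    have hZ : Z ∈ supported K {v : GenericVar k d | ∀ l, v ≠ pureVar d l} := by
      refine Subalgebra.sum_mem _ fun m hm => Subalgebra.mul_mem _ ?_ ?_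
      · simp only [genericCoeff, Finset.ne_of_mem_erase hm, if_false]
        split_ifs
        · exact Subalgebra.zero_mem _
        · exact X_mem_supported.2 fun l => (pureVar_ne_otherVar l _).symm
      · refine Subalgebra.prod_mem _ fun l _ => Subalgebra.pow_mem _ ?_ _
        simp only [genericPoint]
        split_ifs
        · exact Subalgebra.one_mem _
        · exact X_mem_supported.2 fun l' => (pureVar_ne_coordVar l' _).symm
    have hYd : MonomialOrder.lex.degree Y =
        Finsupp.single (pureVar d i) 1 + Finsupp.single (coordVar d i) d := by
      rw [MonomialOrder.degree_monomial, if_neg one_ne_zero]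
    have hpos : 0 ≺[MonomialOrder.lex]
        Finsupp.single (pureVar d i) 1 + Finsupp.single (coordVar d i) d :=
      lex_lt_of_pureVar_eq_zero (fun _ => rfl) i d
    have hlt : MonomialOrder.lex.degree Z ≺[MonomialOrder.lex] MonomialOrder.lex.degree Y := by
      rw [hYd, MonomialOrder.degree_lt_iff hpos]
      intro ν hν
      refine lex_lt_of_pureVar_eq_zero (fun l => ?_) i d
      by_contra h
      exact mem_supported.1 hZ ((mem_vars_iff_mem_support _).2 ⟨ν, hν, Finsupp.mem_support_iff.2 h⟩) l rfl
    have hdeg : MonomialOrder.lex.degree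
        (parametrize 0 (genericPoint K k d) (genericCoeff K k d) (i, pureMon k d 0)) =
        Finsupp.single (pureVar d i) 1 + Finsupp.single (coordVar d i) d := by
      rw [hYZ, MonomialOrder.degree_neg, MonomialOrder.degree_add_of_lt hlt, hYd]
    refine ⟨fun h => ?_, by rw [hdeg]; simp [genericExponent]⟩
    rw [h, MonomialOrder.degree_zero] at hdeg
    rw [← hdeg] at hpos
    exact lt_irrefl _ hpos
  · have h1 : parametrize 0 (genericPoint K k d) (genericCoeff K k d) (i, m) =
        X (if m = pureMon k d i then pureVar d i else otherVar (i, m)) := by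
      simp only [parametrize, hm, if_false, genericPoint, if_true, genericCoeff, one_pow, one_mul,
        sub_zero]
      split_ifs <;> rfl
    rw [h1]
    refine ⟨X_ne_zero _, ?_⟩
    rw [MonomialOrder.degree_X]
    simp only [genericExponent, hm, if_false]
    split_ifs <;> rfl

/-- The exponent of `coordVar d l` recovers the multiplicity of `(l, x_0 ^ d)` for `l ≠ 0`. Given
these, `pureVar d l` recovers that of `(l, x_l ^ d)`, and each other variable belongs to one
coefficient. -/
theorem genericExponent_injective (hd : 0 < d) : Function.Injective
    fun μ : {q : Fin (k + 1) × Mon k d // q ≠ (0, pureMon k d 0)} →₀ ℕ =>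
      ∑ q, μ q • genericExponent k d q.1 := by
  classical
  intro μ ν h
  have h : ∀ v, ∑ q, μ q * genericExponent k d q.1 v = ∑ q, ν q * genericExponent k d q.1 v := by
    intro v
    have := DFunLike.congr_fun h v
    simpa [Finsupp.finsetSum_apply] using this
  have hne : ∀ l, l ≠ 0 → pureMon k d l ≠ pureMon k d 0 := fun l hl => (pureMon_injective hd).ne hl
  have happ : ∀ q v, genericExponent k d q v =
      if q.2 = pureMon k d 0 then
        (if pureVar d q.1 = v then 1 else 0) + if coordVar d q.1 = v then d else 0
      else if q.2 = pureMon k d q.1 then if pureVar d q.1 = v then 1 else 0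
      else if otherVar q = v then 1 else 0 := by
    intro q v
    unfold genericExponent
    split_ifs <;> simp only [Finsupp.add_apply, Finsupp.single_apply] <;> simp only [*, if_true, if_false]
  have hcoord : ∀ q l, genericExponent k d q (coordVar d l) =
      if q = (l, pureMon k d 0) then d else 0 := by
    rintro ⟨i, m⟩ l
    simp only [happ, pureVar_ne_coordVar, (coordVar_ne_otherVar _ _).symm, if_false, ite_self,
      (coordVar_injective (k := k) (d := d)).eq_iff, Prod.mk.injEq, zero_add]
    rw [← ite_and]
    exact if_congr and_comm rfl rfl
  have hother : ∀ q q' : Fin (k + 1) × Mon k d, q'.2 ≠ pureMon k d 0 → q'.2 ≠ pureMon k d q'.1 →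
      genericExponent k d q (otherVar q') = if q = q' then 1 else 0 := by
    intro q q' h1 h2
    simp only [happ, pureVar_ne_otherVar, coordVar_ne_otherVar, if_false,
      (otherVar_injective (k := k) (d := d)).eq_iff, add_zero]
    by_cases h : q = q'
    · subst h
      rw [if_neg h1, if_neg h2]
    · simp only [h, if_false, ite_self]
  have hpure : ∀ (q : Fin (k + 1) × Mon k d) (l : Fin (k + 1)), l ≠ 0 →
      genericExponent k d q (pureVar d l) =
      (if q = (l, pureMon k d 0) then 1 else 0) + if q = (l, pureMon k d l) then 1 else 0 := by
    rintro ⟨i, m⟩ l hl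
    simp only [happ, (pureVar_ne_coordVar _ _).symm, (pureVar_ne_otherVar _ _).symm, if_false,
      (pureVar_injective (k := k) (d := d)).eq_iff, Prod.mk.injEq, add_zero]
    by_cases hil : i = l
    · subst hil
      by_cases hm : m = pureMon k d 0
      · subst hm
        simp only [true_and, if_true, (hne i hl).symm, if_false]
      · simp only [true_and, if_true, hm, if_false, zero_add]
    · simp only [hil, false_and, if_false, ite_self]
  have hsum : ∀ (μ : {q : Fin (k + 1) × Mon k d // q ≠ (0, pureMon k d 0)} →₀ ℕ) q₁ (a : ℕ),
      ∑ q, μ q * (if q.1 = q₁.1 then a else 0) = μ q₁ * a := by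
    intro μ q₁ a
    rw [Finset.sum_eq_single q₁]
    · simp
    · intro q _ hq
      rw [if_neg fun h => hq (Subtype.ext h), mul_zero]
    · simp
  have hfirst : ∀ l (hl : l ≠ 0), μ ⟨(l, pureMon k d 0), by simp [hl]⟩ =
      ν ⟨(l, pureMon k d 0), by simp [hl]⟩ := by
    intro l hl
    have := h (coordVar d l)
    simp_rw [hcoord] at this
    rw [hsum μ ⟨(l, pureMon k d 0), by simp [hl]⟩ d, hsum ν ⟨(l, pureMon k d 0), by simp [hl]⟩ d] at this
    exact Nat.eq_of_mul_eq_mul_right hd this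
  ext ⟨⟨i, m⟩, hq⟩
  by_cases hm : m = pureMon k d 0
  · subst hm
    exact hfirst i fun h => hq (by rw [h])
  by_cases hmi : m = pureMon k d i
  · subst hmi
    have hi : i ≠ 0 := fun h => hm (by rw [h])
    have := h (pureVar d i)
    simp_rw [hpure _ i hi, mul_add, Finset.sum_add_distrib] at this
    rw [hsum μ ⟨(i, pureMon k d 0), by simp [hi]⟩ 1, hsum ν ⟨(i, pureMon k d 0), by simp [hi]⟩ 1,
      hsum μ ⟨(i, pureMon k d i), hq⟩ 1, hsum ν ⟨(i, pureMon k d i), hq⟩ 1, hfirst i hi] at this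
    omega
  · have := h (otherVar (i, m))
    simp_rw [fun q => hother q (i, m) hm hmi] at this
    rw [hsum μ ⟨(i, m), hq⟩ 1, hsum ν ⟨(i, m), hq⟩ 1] at this
    omega

variable {L : Type*} [Field L] [Algebra K L]

variable (K L) in
/-- The ideal of the systems of `k + 1` forms of degree `d` with a non-trivial common zero is
generated by one prime element. -/
theorem exists_prime_span_eq_vanishingIdeal [IsAlgClosed L] (hd : 0 < d) :
    ∃ R, Prime R ∧ vanishingIdeal K (solvableSystems L k d) = Ideal.span {R} := by
  classical
  have : Infinite L := IsAlgClosed.instInfinite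
  have := isPrime_vanishingIdeal_solvableSystems (k := k) K L hd
  refine exists_prime_span_eq_of_rename (0, pureMon k d 0)
    (vanishingIdeal_solvableSystems_ne_bot K L hd) fun H hH => ?_
  -- An element of the ideal free of the coefficient `(0, x_0 ^ d)` is a relation among independent
  -- polynomials.
  have h1 := aeval_aeval_parametrize (0 : Fin (k + 1)) (rename Subtype.val H)
    (Sum.elim (genericPoint K k d) (genericCoeff K k d))
  rw [aeval_parametrize_eq_zero hd hH, map_zero] at h1
  simp only [Sum.elim_inl, Sum.elim_inr] at h1
  rw [aeval_rename] at h1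
  refine eq_zero_of_aeval_eq_zero_of_injective_degree MonomialOrder.lex
    (fun q => (degree_generic hd q.2).1) ?_ h1.symm
  convert genericExponent_injective hd using 4 with μ q
  exact (degree_generic hd q.2).2

end Generic

/-! ### Weighted homogeneity through a scaling variable. -/

section WeightScale

variable {K τ : Type*} [Field K]

/-- Multiply each variable `q` by the power of a new variable given by its weight `w q`. -/
def weightScale (w : τ → ℕ) : MvPolynomial τ K →ₐ[K] Polynomial (MvPolynomial τ K) :=
  aeval fun q => Polynomial.X ^ w q * Polynomial.C (X q)

theorem coeff_weightScale (w : τ → ℕ) (f : MvPolynomial τ K) (n : ℕ) :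
    (weightScale w f).coeff n = weightedHomogeneousComponent w n f := by
  classical
  induction f using MvPolynomial.induction_on' with
  | monomial μ a =>
    have h1 : weightScale w (monomial μ a) =
        Polynomial.X ^ Finsupp.weight w μ * Polynomial.C (monomial μ a) := by
      rw [weightScale, aeval_monomial, Finsupp.weight_apply, Finsupp.prod, Finsupp.sum]
      simp_rw [mul_pow, Finset.prod_mul_distrib, ← pow_mul, Finset.prod_pow_eq_pow_sum]
      rw [monomial_eq, Finsupp.prod, map_mul, map_prod, Polynomial.algebraMap_apply,
        MvPolynomial.algebraMap_eq]
      simp_rw [map_pow, smul_eq_mul, mul_comm (w _)]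
      ring
    rw [h1, Polynomial.coeff_X_pow_mul', weightedHomogeneousComponent_of_mem
      (isWeightedHomogeneous_monomial w μ a rfl)]
    by_cases h : n = Finsupp.weight w μ
    · simp [h]
    · rw [if_neg h]
      split_ifs with h'
      · rw [Polynomial.coeff_C_of_ne_zero (by omega)]
      · rfl
  | add p q hp hq => rw [map_add, Polynomial.coeff_add, hp, hq, map_add]

theorem isWeightedHomogeneous_iff_weightScale {w : τ → ℕ} {f : MvPolynomial τ K} {n : ℕ} :
    IsWeightedHomogeneous w f n ↔ weightScale w f = Polynomial.X ^ n * Polynomial.C f := by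
  classical
  constructor
  · intro h
    ext1 e
    rw [coeff_weightScale, weightedHomogeneousComponent_of_mem h, Polynomial.coeff_X_pow_mul']
    by_cases he : e = n
    · simp [he]
    · rw [if_neg he]
      split_ifs with h'
      · rw [Polynomial.coeff_C_of_ne_zero (by omega)]
      · rfl
  · intro h
    have h1 := coeff_weightScale w f n
    rw [h, Polynomial.coeff_X_pow_mul', if_pos le_rfl, Nat.sub_self, Polynomial.coeff_C_zero] at h1
    rw [h1]
    exact weightedHomogeneousComponent_isWeightedHomogeneous _ _

/-- A factor of a weighted homogeneous polynomial is weighted homogeneous, if the other factor is. -/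
theorem IsWeightedHomogeneous.of_mul_left {w : τ → ℕ} {f g : MvPolynomial τ K} {m n : ℕ}
    (hf : IsWeightedHomogeneous w f m) (hf0 : f ≠ 0) (h : IsWeightedHomogeneous w (f * g) n) :
    IsWeightedHomogeneous w g (n - m) := by
  classical
  have h1 : Polynomial.X ^ m * weightScale w g = Polynomial.X ^ n * Polynomial.C g := by
    have hC : (Polynomial.C f : Polynomial (MvPolynomial τ K)) ≠ 0 := by simpa using hf0
    apply mul_left_cancel₀ hC
    have h2 := isWeightedHomogeneous_iff_weightScale.1 h
    rw [map_mul, isWeightedHomogeneous_iff_weightScale.1 hf, map_mul] at h2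
    linear_combination h2
  intro μ hμ
  -- A nonzero coefficient forces `m + weight = n`, so the truncated `n - m` is a true difference.
  have h2 := congrArg (fun p => coeff μ (p.coeff (m + Finsupp.weight w μ))) h1
  simp only [Polynomial.coeff_X_pow_mul', le_add_iff_nonneg_right, zero_le, if_true,
    add_tsub_cancel_left, coeff_weightScale, coeff_weightedHomogeneousComponent] at h2
  split_ifs at h2 with h3
  · by_cases h4 : m + Finsupp.weight w μ - n = 0
    · omega
    · rw [Polynomial.coeff_C_of_ne_zero h4, coeff_zero] at h2
      exact absurd h2 hμ
  · exact absurd h2 hμ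

theorem eval₂_weightScale {B : Type*} [CommRing B] [Algebra K B] (w : τ → ℕ)
    (f : MvPolynomial τ K) (z : τ → B) (t : B) :
    Polynomial.eval₂ (aeval z : MvPolynomial τ K →ₐ[K] B).toRingHom t (weightScale w f) =
      aeval (fun q => t ^ w q * z q) f := by
  have : (Polynomial.eval₂RingHom (aeval z : MvPolynomial τ K →ₐ[K] B).toRingHom t).comp
      (weightScale w : MvPolynomial τ K →ₐ[K] _).toRingHom =
      (aeval (fun q => t ^ w q * z q) : MvPolynomial τ K →ₐ[K] B).toRingHom := by
    apply MvPolynomial.ringHom_ext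
    · intro a
      simp [MvPolynomial.algebraMap_eq, Polynomial.algebraMap_apply]
    · intro q
      simp [weightScale, mul_comm (z q)]
  exact RingHom.congr_fun this f

end WeightScale

/-! ### Generators of ideals of sets stable under scaling. -/

section Stable

variable {K L τ : Type*} [Field K] [Field L] [Algebra K L] [Infinite L]

/-- A polynomial in `t` with infinitely many zeros has only zero coefficients. -/
theorem coeff_mem_vanishingIdeal {W : Set (τ → L)} {U : Polynomial (MvPolynomial τ K)}
    (h : ∀ c ∈ W, ∀ t : L,
      Polynomial.eval₂ (aeval c : MvPolynomial τ K →ₐ[K] L).toRingHom t U = 0) (n : ℕ) :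
    U.coeff n ∈ vanishingIdeal K W := by
  intro c hc
  have h1 : U.map (aeval c : MvPolynomial τ K →ₐ[K] L).toRingHom = 0 := by
    refine Polynomial.funext fun t => ?_
    rw [Polynomial.eval_map, h c hc t, Polynomial.eval_zero]
  have := congrArg (fun p => p.coeff n) h1
  simpa using this

theorem weightedHomogeneousComponent_mem_vanishingIdeal {W : Set (τ → L)} {w : τ → ℕ}
    (hW : ∀ c ∈ W, ∀ t : L, (fun q => t ^ w q * c q) ∈ W) {f : MvPolynomial τ K}
    (hf : f ∈ vanishingIdeal K W) (n : ℕ) :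
    weightedHomogeneousComponent w n f ∈ vanishingIdeal K W := by
  rw [← coeff_weightScale]
  refine coeff_mem_vanishingIdeal (fun c hc t => ?_) n
  rw [eval₂_weightScale]
  exact mem_vanishingIdeal_iff.1 hf _ (hW c hc t)

theorem totalDegree_weightedHomogeneousComponent_le (w : τ → ℕ) (n : ℕ) (f : MvPolynomial τ K) :
    (weightedHomogeneousComponent w n f).totalDegree ≤ f.totalDegree := by
  classical
  refine Finset.sup_mono fun μ hμ => ?_
  rw [mem_support_iff, coeff_weightedHomogeneousComponent] at hμ
  split_ifs at hμ with h
  · exact mem_support_iff.2 hμ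
  · exact absurd rfl hμ

/-- A nonzero component of `R` lies in the ideal, so it is a multiple of `R` of no larger degree,
that is, a constant multiple. -/
theorem exists_isWeightedHomogeneous_of_span_eq {W : Set (τ → L)} {w : τ → ℕ}
    (hW : ∀ c ∈ W, ∀ t : L, (fun q => t ^ w q * c q) ∈ W) {R : MvPolynomial τ K} (hR : R ≠ 0)
    (hspan : vanishingIdeal K W = Ideal.span {R}) : ∃ n, IsWeightedHomogeneous w R n := by
  classical
  obtain ⟨μ, hμ⟩ := support_nonempty.2 hR
  refine ⟨Finsupp.weight w μ, ?_⟩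
  have hmem := weightedHomogeneousComponent_mem_vanishingIdeal hW
    (hspan ▸ Ideal.mem_span_singleton_self R) (Finsupp.weight w μ)
  rw [hspan, Ideal.mem_span_singleton] at hmem
  obtain ⟨Q, hQ⟩ := hmem
  have hdeg := totalDegree_weightedHomogeneousComponent_le w (Finsupp.weight w μ) R
  have hQ0 : Q ≠ 0 := by
    rintro rfl
    rw [mul_zero] at hQ
    have := congrArg (coeff μ) hQ
    rw [coeff_weightedHomogeneousComponent, if_pos rfl] at this
    exact mem_support_iff.1 hμ this
  rw [hQ, totalDegree_mul_of_isDomain hR hQ0] at hdeg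
  obtain ⟨a, ha⟩ : ∃ a, Q = C a := ⟨_, totalDegree_eq_zero_iff_eq_C.1 (by omega)⟩
  have ha0 : a ≠ 0 := by rintro rfl; exact hQ0 (by rw [ha, map_zero])
  have h1 : C a * R = weightedHomogeneousComponent w (Finsupp.weight w μ) R := by
    rw [hQ, ha, mul_comm]
  intro ν hν
  have h2 := congrArg (coeff ν) h1
  rw [coeff_C_mul, coeff_weightedHomogeneousComponent] at h2
  by_contra h3
  rw [if_neg h3] at h2
  exact mul_ne_zero ha0 hν h2

end Stable

/-! ### Invariance of the generator under row operations. -/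

section StableRows

variable {K L : Type*} [Field K] [Field L] [Algebra K L] [Infinite L] {r : ℕ} {ι : Type*}

theorem aeval_constEntry {ρ : Type*} (f : MvPolynomial (ρ × ι) K) :
    aeval (constEntry K ρ ι) f = Polynomial.C f := by
  have := aeval_algebraMap_apply (A := MvPolynomial (ρ × ι) K)
    (Polynomial (MvPolynomial (ρ × ι) K)) X f
  rw [aeval_X_left_apply] at this
  exact this

theorem rowShift_zero {B : Type*} [CommRing B] (i j : Fin r) (z : Fin r × ι → B) :
    rowShift i j 0 z = z := by
  funext q
  simp [rowShift]

theorem rowShift_rowShift_neg {B : Type*} [CommRing B] {i j : Fin r} (hij : i ≠ j) (t : B)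
    (z : Fin r × ι → B) : rowShift i j t (rowShift i j (-t) z) = z := by
  funext q
  by_cases hq : q.1 = j
  · simp [rowShift, hq, hij]
  · simp [rowShift, hq]

/-- The shifted `R` is `R * Q`. Undoing the shift makes `Q` a unit, hence constant in the parameter,
and parameter zero gives `Q = 1`. -/
theorem rowShiftInvariant_of_span_eq {i j : Fin r} (hij : i ≠ j) {W : Set (Fin r × ι → L)}
    (hW : ∀ c ∈ W, ∀ t : L, rowShift i j t c ∈ W) {R : MvPolynomial (Fin r × ι) K} (hR : R ≠ 0)
    (hspan : vanishingIdeal K W = Ideal.span {R}) : RowShiftInvariant i j R := by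
  have hRW : R ∈ vanishingIdeal K W := hspan ▸ Ideal.mem_span_singleton_self R
  obtain ⟨Q, hQ⟩ : (Polynomial.C R : Polynomial (MvPolynomial (Fin r × ι) K)) ∣
      aeval (rowShift i j Polynomial.X (constEntry K (Fin r) ι)) R := by
    refine (Polynomial.C_dvd_iff_dvd_coeff _ _).2 fun n => ?_
    rw [← Ideal.mem_span_singleton, ← hspan]
    refine coeff_mem_vanishingIdeal (fun c hc t => ?_) n
    rw [← aeval_rowShift_eq_eval₂]
    exact mem_vanishingIdeal_iff.1 hRW _ (hW c hc t)
  have hC : (Polynomial.C R : Polynomial (MvPolynomial (Fin r × ι) K)) ≠ 0 := by simpa using hR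
  have h1 : aeval (rowShift i j (-Polynomial.X) (constEntry K (Fin r) ι)) R =
      Polynomial.C R * Q.comp (-Polynomial.X) := by
    have hcomp : (aeval (constEntry K (Fin r) ι) : MvPolynomial (Fin r × ι) K →ₐ[K] _).toRingHom =
      Polynomial.C := RingHom.ext aeval_constEntry
    rw [aeval_rowShift_eq_eval₂, hQ, hcomp, ← Polynomial.comp, Polynomial.mul_comp,
      Polynomial.C_comp]
  have h2 := aeval_rowShift_eq_eval₂ (i := i) (j := j) R
    (rowShift i j (-Polynomial.X) (constEntry K (Fin r) ι)) Polynomial.X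
  rw [rowShift_rowShift_neg hij, aeval_constEntry, hQ, Polynomial.eval₂_mul, Polynomial.eval₂_C] at h2
  have h3 : (aeval (rowShift i j (-Polynomial.X) (constEntry K (Fin r) ι)) :
      MvPolynomial (Fin r × ι) K →ₐ[K] _).toRingHom R = Polynomial.C R * Q.comp (-Polynomial.X) := h1
  rw [h3, mul_assoc] at h2
  have h4 := mul_left_cancel₀ hC ((mul_one _).trans h2)
  obtain ⟨u, -, hu⟩ := Polynomial.isUnit_iff.1 (IsUnit.of_mul_eq_one _ h4.symm)
  have hQu : Q = Polynomial.C u := by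
    have := congrArg (fun p => p.comp (-Polynomial.X)) hu
    simp only [Polynomial.C_comp, Polynomial.comp_assoc, Polynomial.neg_comp, Polynomial.X_comp,
      neg_neg, Polynomial.comp_X] at this
    exact this.symm
  have h5 := aeval_rowShift_eq_eval₂ (i := i) (j := j) R (X : Fin r × ι → MvPolynomial _ K) 0
  rw [rowShift_zero, hQ, hQu, ← map_mul, Polynomial.eval₂_C] at h5
  have h6 : R = R * u := by
    simpa [aeval_X_left_apply] using h5
  rw [RowShiftInvariant, hQ, hQu, ← map_mul, ← h6]

/-- The case `n = 0` of `rowDegree_le_of_natDegree_rowShift_le`, used for both orders of each pair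
of rows. -/
theorem exists_rowHomogeneous_of_rowShiftInvariant [Fintype ι] {f : MvPolynomial (Fin r × ι) K}
    (hf : f ≠ 0) (hs : ∀ i j, i ≠ j → RowShiftInvariant i j f)
    (hr : ∀ s, ∃ n, RowHomogeneous s f n) : ∃ D, ∀ s, RowHomogeneous s f D := by
  classical
  choose n hn using hr
  have hle : ∀ i j, n j ≤ n i := by
    intro i j
    by_cases hij : i = j
    · rw [hij]
    refine rowDegree_le_of_natDegree_rowShift_le hij hf (hn i) (hn j) (n := 0) ?_
    rw [(hs i j hij).aeval_rowShift, aeval_constEntry, Polynomial.natDegree_C]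
  rcases isEmpty_or_nonempty (Fin r) with h | ⟨⟨s⟩⟩
  · exact ⟨0, fun s => h.elim s⟩
  · exact ⟨n s, fun s' => le_antisymm (hle s' s) (hle s s') ▸ hn s'⟩

end StableRows

/-! ### Divisibility among bracket polynomials. -/

section BracketIdeal

variable {K L : Type*} [Field K] [Field L] [Algebra K L] {r : ℕ} {ι : Type*} [LinearOrder ι]

theorem substMinors_add (F G : MvPolynomial (Fin r ↪o ι) K) :
    substMinors (F + G) = substMinors F + substMinors G := map_add _ _ _

theorem substMinors_mul (F G : MvPolynomial (Fin r ↪o ι) K) :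
    substMinors (F * G) = substMinors F * substMinors G := map_mul _ _ _

theorem substMinors_sum {α : Type*} (s : Finset α) (F : α → MvPolynomial (Fin r ↪o ι) K) :
    substMinors (∑ a ∈ s, F a) = ∑ a ∈ s, substMinors (F a) := map_sum _ _ _

/-- Every minor is linear in row `s`, so degree in that row counts brackets. -/
theorem weightedHomogeneousComponent_substMinors [Fintype ι] (s : Fin r)
    (G : MvPolynomial (Fin r ↪o ι) K) (e : ℕ) :
    weightedHomogeneousComponent (rowWeight ι s) e (substMinors G) =
      substMinors (homogeneousComponent e G) := by
  have h : ∀ n, weightedHomogeneousComponent (rowWeight ι s) e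
      (substMinors (homogeneousComponent n G)) =
      if e = n then substMinors (homogeneousComponent n G) else 0 := fun n =>
    weightedHomogeneousComponent_of_mem (rowHomogeneous_iff.1
      (rowHomogeneous_substMinors s (homogeneousComponent_isHomogeneous n G)))
  conv_lhs => rw [← sum_homogeneousComponent G, substMinors_sum, map_sum]
  simp_rw [h, Finset.sum_ite_eq, Finset.mem_range]
  split_ifs with he
  · rfl
  · rw [homogeneousComponent_eq_zero _ _ (by omega)]
    exact (map_zero _).symm

/-- A polynomial in the brackets that is divisible by a homogeneous polynomial in the brackets is a
multiple of it by a polynomial in the brackets. -/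
theorem exists_substMinors_eq_mul [Fintype ι] {D e : ℕ} {F G : MvPolynomial (Fin r ↪o ι) K}
    (hF : F.IsHomogeneous D) (hF0 : substMinors F ≠ 0) (hG : G.IsHomogeneous e)
    (hdvd : substMinors F ∣ substMinors G) :
    ∃ Q, substMinors G = substMinors (F * Q) := by
  obtain ⟨q, hq⟩ := hdvd
  -- The quotient of two invariants is invariant, and row homogeneous by the same cancellation.
  obtain ⟨Q, -, hQ⟩ := exists_substMinors_eq (f := q) (D := e - D)
    (fun i j hij => by
      have h1 := rowShiftInvariant_substMinors hij.ne G
      have h2 := rowShiftInvariant_substMinors hij.ne F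
      rw [RowShiftInvariant] at *
      rw [hq, map_mul, h2, map_mul] at h1
      exact mul_left_cancel₀ (by simpa using hF0) h1)
    (fun s => rowHomogeneous_iff.2 (IsWeightedHomogeneous.of_mul_left
      (rowHomogeneous_iff.1 (rowHomogeneous_substMinors s hF)) hF0
      (hq ▸ rowHomogeneous_iff.1 (rowHomogeneous_substMinors s hG))))
  exact ⟨Q, by rw [substMinors_mul, hQ, hq]⟩

/-- `G` need not be homogeneous; stability under scaling one row puts each component into the ideal
separately. -/
theorem exists_substMinors_eq_mul_of_mem [Infinite L] [Fintype ι] (s : Fin r)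
    {W : Set (Fin r × ι → L)}
    (hW : ∀ c ∈ W, ∀ t : L, (fun q => t ^ rowWeight ι s q * c q) ∈ W)
    {D : ℕ} {F : MvPolynomial (Fin r ↪o ι) K} (hF : F.IsHomogeneous D) (hF0 : substMinors F ≠ 0)
    (hspan : vanishingIdeal K W = Ideal.span {substMinors F})
    {G : MvPolynomial (Fin r ↪o ι) K} (hG : substMinors G ∈ vanishingIdeal K W) :
    ∃ Q, substMinors G = substMinors (F * Q) := by
  have h : ∀ e, ∃ Q, substMinors (homogeneousComponent e G) = substMinors (F * Q) := by
    intro e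
    refine exists_substMinors_eq_mul hF hF0 (homogeneousComponent_isHomogeneous e G) ?_
    rw [← Ideal.mem_span_singleton, ← hspan, ← weightedHomogeneousComponent_substMinors s]
    exact weightedHomogeneousComponent_mem_vanishingIdeal hW hG e
  choose Q hQ using h
  refine ⟨∑ e ∈ Finset.range (G.totalDegree + 1), Q e, ?_⟩
  conv_lhs => rw [← sum_homogeneousComponent G, substMinors_sum]
  rw [Finset.mul_sum, substMinors_sum]
  exact Finset.sum_congr rfl fun e _ => hQ e

theorem exists_substMinors_of_span_eq [Infinite L] [Fintype ι] {W : Set (Fin r × ι → L)}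
    (hshift : ∀ i j, i ≠ j → ∀ c ∈ W, ∀ t : L, rowShift i j t c ∈ W)
    (hscale : ∀ s, ∀ c ∈ W, ∀ t : L, (fun q => t ^ rowWeight ι s q * c q) ∈ W)
    {R : MvPolynomial (Fin r × ι) K} (hR : R ≠ 0)
    (hspan : vanishingIdeal K W = Ideal.span {R}) :
    ∃ D, ∃ F : MvPolynomial (Fin r ↪o ι) K, F.IsHomogeneous D ∧ substMinors F = R := by
  have hs : ∀ i j, i ≠ j → RowShiftInvariant i j R := fun i j hij =>
    rowShiftInvariant_of_span_eq hij (hshift i j hij) hR hspan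
  obtain ⟨D, hD⟩ := exists_rowHomogeneous_of_rowShiftInvariant hR hs fun s => by
    obtain ⟨n, hn⟩ := exists_isWeightedHomogeneous_of_span_eq (hscale s) hR hspan
    exact ⟨n, rowHomogeneous_iff.2 hn⟩
  obtain ⟨F, hF, hFR⟩ := exists_substMinors_eq (fun i j hij => hs i j hij.ne) hD
  exact ⟨D, F, hF, hFR⟩

end BracketIdeal

/-! ### The cone over the Grassmannian. -/

section Cone

variable {K L : Type*} [Field K] [Field L] [Algebra K L] {r : ℕ} {ι : Type*} [LinearOrder ι]

theorem pluckerVector_zero (hr : 0 < r) : pluckerVector (0 : Matrix (Fin r) ι L) = 0 := by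
  have : Nonempty (Fin r) := ⟨⟨0, hr⟩⟩
  funext I
  exact Matrix.det_zero

/-- The kernel of a matrix with a maximal minor that does not vanish, as a point of the
Grassmannian. -/
theorem exists_grassmannian_eq_ker [Fintype ι] {A : Matrix (Fin r) ι L} (hA : pluckerVector A ≠ 0) :
    ∃ N : Module.Grassmannian L (ι → L) r, LinearMap.ker A.mulVecLin = N.toSubmodule := by
  classical
  obtain ⟨I, hI⟩ := Function.ne_iff.1 hA
  have hrows : LinearIndependent L A.row := by
    have h1 : LinearIndependent L (A.submatrix id I).row :=
      Matrix.linearIndependent_rows_of_det_ne_zero hI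
    exact LinearIndependent.of_comp (LinearMap.funLeft L L I) h1
  have hsurj : Function.Surjective A.mulVecLin := by
    rw [← LinearMap.range_eq_top]
    apply Submodule.eq_top_of_finrank_eq
    have := hrows.rank_matrix
    rw [Matrix.rank, Fintype.card_fin] at this
    rw [this, Module.finrank_fin_fun]
  have e := A.mulVecLin.quotKerEquivOfSurjective hsurj
  refine ⟨⟨LinearMap.ker A.mulVecLin, Module.Finite.equiv e.symm, inferInstance, fun p => ?_⟩, rfl⟩
  rw [Module.rankAtStalk_eq_of_equiv e, Module.rankAtStalk_eq_finrank_of_free]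
  simp

/-- Every matrix has its vector of minors in the cone: it is zero, or the kernel has codimension
`r`. For `r > 0` the origin is itself the vector of the zero matrix. -/
theorem vanishingIdeal_pluckerCone_univ [Infinite L] [Fintype ι] (hr : 0 < r)
    (G : MvPolynomial (Fin r ↪o ι) K) :
    G ∈ vanishingIdeal K
      (pluckerCone (Set.univ : Set (Module.Grassmannian L (ι → L) r))) ↔ substMinors G = 0 := by
  rw [mem_vanishingIdeal_iff]
  constructor
  · intro h
    refine eq_zero_of_forall_aeval_eq_zero (L := L) fun z => ?_
    rw [aeval_substMinors]
    apply h
    by_cases h0 : pluckerVector (Matrix.of fun i j => z (i, j)) = 0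
    · exact Or.inl h0
    · obtain ⟨N, hN⟩ := exists_grassmannian_eq_ker h0
      exact Or.inr ⟨N, trivial, _, hN, rfl⟩
  · intro h
    have hA : ∀ A : Matrix (Fin r) ι L, aeval (pluckerVector A) G = 0 := by
      intro A
      have := aeval_substMinors (fun q => A q.1 q.2) G
      rw [h, map_zero] at this
      exact this.symm
    rintro p (rfl | ⟨N, -, A, -, rfl⟩)
    · rw [← pluckerVector_zero hr]
      exact hA 0
    · exact hA A

end Cone

/-! ### Resultants are the associates of the generator. -/

section Resultant

variable {K L : Type*} [Field K] [Field L] [Algebra K L] {k d : ℕ}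

theorem mem_solvableSystems_iff {c : Fin (k + 1) × Mon k d → L} : c ∈ solvableSystems L k d ↔
    ∃ x : Fin (k + 1) → L, x ≠ 0 ∧ ∀ i, ∑ m, c (i, m) * monomials k d x m = 0 := by
  simp only [solvableSystems, Set.mem_ofPred_eq, eval_form]

theorem rowShift_mem_solvableSystems (i j : Fin (k + 1)) {c : Fin (k + 1) × Mon k d → L}
    (hc : c ∈ solvableSystems L k d) (t : L) : rowShift i j t c ∈ solvableSystems L k d := by
  rw [mem_solvableSystems_iff] at *
  obtain ⟨x, hx, h⟩ := hc
  refine ⟨x, hx, fun l => ?_⟩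
  simp only [rowShift, add_mul, Finset.sum_add_distrib, h, zero_add]
  split_ifs
  · simp only [mul_assoc, ← Finset.mul_sum, h, mul_zero]
  · simp

theorem rowScale_mem_solvableSystems (s : Fin (k + 1)) {c : Fin (k + 1) × Mon k d → L}
    (hc : c ∈ solvableSystems L k d) (t : L) :
    (fun q => t ^ rowWeight (Mon k d) s q * c q) ∈ solvableSystems L k d := by
  rw [mem_solvableSystems_iff] at *
  obtain ⟨x, hx, h⟩ := hc
  refine ⟨x, hx, fun l => ?_⟩
  simp_rw [mul_assoc]
  refine (Finset.mul_sum Finset.univ (fun m => c (l, m) * monomials k d x m)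
    (t ^ rowWeight (Mon k d) s (l, pureMon k d 0))).symm.trans ?_
  rw [h, mul_zero]

variable (K L) in
/-- The ideal of the systems of `k + 1` forms of degree `d` with a non-trivial common zero is
generated by a prime element that is a homogeneous polynomial in the brackets. -/
theorem exists_substMinors_span_eq [IsAlgClosed L] (hd : 0 < d) :
    ∃ D, ∃ F : MvPolynomial (Fin (k + 1) ↪o Mon k d) K, F.IsHomogeneous D ∧
      Prime (substMinors F) ∧
      vanishingIdeal K (solvableSystems L k d) = Ideal.span {substMinors F} := by
  have : Infinite L := IsAlgClosed.instInfinite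
  obtain ⟨R, hR, hspan⟩ := exists_prime_span_eq_vanishingIdeal (k := k) K L hd
  obtain ⟨D, F, hF, rfl⟩ := exists_substMinors_of_span_eq
    (fun i j _ c hc t => rowShift_mem_solvableSystems i j hc t)
    (fun s c hc t => rowScale_mem_solvableSystems s hc t) hR.ne_zero hspan
  exact ⟨D, F, hF, hR, hspan⟩

/-- Away from the solvable systems some eliminant is nonzero; it is a multiple of `R`, so `R` is
nonzero there too. -/
theorem aeval_eq_zero_iff_mem_solvableSystems [IsAlgClosed L] {R : MvPolynomial _ K}
    (hspan : vanishingIdeal K (solvableSystems L k d) = Ideal.span {R})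
    (c : Fin (k + 1) × Mon k d → L) : aeval c R = 0 ↔ c ∈ solvableSystems L k d := by
  constructor
  · intro h
    by_contra hc
    obtain ⟨G, hG, hG'⟩ := exists_eliminant K (fun i m => c (i, m)) hc
    have hmem : G ∈ vanishingIdeal K (solvableSystems L k d) :=
      mem_vanishingIdeal_iff.2 fun c' hc' => hG' (fun i m => c' (i, m)) hc'
    rw [hspan, Ideal.mem_span_singleton] at hmem
    obtain ⟨Q, rfl⟩ := hmem
    rw [map_mul] at hG
    exact left_ne_zero_of_mul hG h
  · exact mem_vanishingIdeal_iff.1 (hspan ▸ Ideal.mem_span_singleton_self R) c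

theorem isResultant_iff_associated {R R' : MvPolynomial (Fin (k + 1) × Mon k d) K} (hR : Prime R)
    (hspan : vanishingIdeal K (solvableSystems (AlgebraicClosure K) k d) = Ideal.span {R}) :
    IsResultant K k d R' ↔ Associated R R' := by
  constructor
  · intro h
    have hmem : R' ∈ vanishingIdeal K (solvableSystems (AlgebraicClosure K) k d) :=
      mem_vanishingIdeal_iff.2 fun c hc => (h.vanishes_iff fun i m => c (i, m)).2 hc
    rw [hspan, Ideal.mem_span_singleton] at hmem
    exact hR.irreducible.associated_of_dvd h.irreducible hmem
  · intro h
    refine ⟨h.irreducible_iff.1 hR.irreducible, fun c => ?_⟩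
    rw [Ideal.span_singleton_eq_span_singleton.2 h] at hspan
    exact aeval_eq_zero_iff_mem_solvableSystems hspan _

theorem associated_iff_exists_smul {τ : Type*} {R R' : MvPolynomial τ K} :
    Associated R R' ↔ ∃ c : K, c ≠ 0 ∧ R' = c • R := by
  constructor
  · rintro ⟨u, rfl⟩
    obtain ⟨c, hc, hu⟩ := isUnit_iff_eq_C_of_isReduced.1 u.isUnit
    exact ⟨c, hc.ne_zero, by rw [hu, smul_eq_C_mul, mul_comm]⟩
  · rintro ⟨c, hc, rfl⟩
    rw [smul_eq_C_mul]
    exact (associated_unit_mul_left _ _ ((isUnit_iff_ne_zero.2 hc).map C)).symm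

end Resultant

/-! ### Existence and uniqueness of the Chow form. -/

section ChowForm

variable {K L : Type*} [Field K] [Field L] {k d : ℕ}

theorem mem_chowDivisor_veronese_iff {r : ℕ} {N : Module.Grassmannian L (Mon k d → L) r} :
    N ∈ chowDivisor r (Set.range (veronese L k d)) ↔
      ∃ x : Fin (k + 1) → L, x ≠ 0 ∧ monomials k d x ∈ N.toSubmodule := by
  constructor
  · rintro ⟨⟨p, N⟩, ⟨h1, ⟨y, rfl⟩⟩, rfl⟩
    induction y using Projectivization.ind with
    | h x hx =>
      refine ⟨x, hx, ?_⟩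
      have h2 : (veronese L k d (Projectivization.mk L x hx)).submodule ≤ N.toSubmodule := h1
      rw [veronese, Projectivization.lift_mk, Projectivization.submodule_mk,
        Submodule.span_singleton_le_iff_mem] at h2
      exact h2
  · rintro ⟨x, hx, h⟩
    refine ⟨(veronese L k d (Projectivization.mk L x hx), N), ⟨?_, ⟨Projectivization.mk L x hx, rfl⟩⟩, rfl⟩
    change (veronese L k d (Projectivization.mk L x hx)).submodule ≤ N.toSubmodule
    rw [veronese, Projectivization.lift_mk, Projectivization.submodule_mk,
      Submodule.span_singleton_le_iff_mem]
    exact h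

theorem mem_chowDivisor_veronese_iff_mem_solvableSystems
    {N : Module.Grassmannian L (Mon k d → L) (k + 1)} {A : Matrix (Fin (k + 1)) (Mon k d) L}
    (h : LinearMap.ker A.mulVecLin = N.toSubmodule) :
    N ∈ chowDivisor (k + 1) (Set.range (veronese L k d)) ↔
      (fun q => A q.1 q.2) ∈ solvableSystems L k d := by
  rw [mem_chowDivisor_veronese_iff, mem_solvableSystems_iff, ← h]
  simp only [LinearMap.mem_ker, Matrix.mulVecLin_apply, funext_iff, Matrix.mulVec, dotProduct,
    Pi.zero_apply]

theorem isChowForm_of_span_eq {D : ℕ} {F : MvPolynomial (Fin (k + 1) ↪o Mon k d) K}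
    (hF : F.IsHomogeneous D) (hF0 : substMinors F ≠ 0)
    (hspan : vanishingIdeal K (solvableSystems (AlgebraicClosure K) k d) =
      Ideal.span {substMinors F}) :
    IsChowForm K (k + 1) (Set.range (veronese (AlgebraicClosure K) k d)) F := by
  have hv : ∀ (N : Module.Grassmannian (AlgebraicClosure K) (Mon k d → AlgebraicClosure K) (k + 1))
      (A : Matrix (Fin (k + 1)) (Mon k d) (AlgebraicClosure K)),
      LinearMap.ker A.mulVecLin = N.toSubmodule → (aeval (pluckerVector A) F = 0 ↔
        N ∈ chowDivisor (k + 1) (Set.range (veronese (AlgebraicClosure K) k d))) := by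
    intro N A hA
    rw [mem_chowDivisor_veronese_iff_mem_solvableSystems hA,
      ← aeval_eq_zero_iff_mem_solvableSystems hspan, aeval_substMinors]
    rfl
  refine ⟨⟨D, hF⟩, hv, le_antisymm (fun G hG => ?_) (sup_le ?_ ?_)⟩
  · have hmem : substMinors G ∈ vanishingIdeal K (solvableSystems (AlgebraicClosure K) k d) := by
      refine mem_vanishingIdeal_iff.2 fun c hc => ?_
      rw [aeval_substMinors]
      apply mem_vanishingIdeal_iff.1 hG
      by_cases h0 : pluckerVector (Matrix.of fun i j => c (i, j)) = 0
      · exact Or.inl h0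
      · obtain ⟨N, hN⟩ := exists_grassmannian_eq_ker h0
        exact Or.inr ⟨N, (mem_chowDivisor_veronese_iff_mem_solvableSystems hN).2 hc, _, hN, rfl⟩
    obtain ⟨Q, hQ⟩ := exists_substMinors_eq_mul_of_mem 0
      (fun c hc t => rowScale_mem_solvableSystems 0 hc t) hF hF0 hspan hmem
    have hG' : G = F * Q + (G - F * Q) := by ring
    rw [hG']
    refine Submodule.add_mem_sup (Ideal.mul_mem_right _ _ (Ideal.mem_span_singleton_self F)) ?_
    rw [vanishingIdeal_pluckerCone_univ k.succ_pos, substMinors, map_sub]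
    exact sub_eq_zero.2 hQ
  · rw [Ideal.span_singleton_le_iff_mem, mem_vanishingIdeal_iff]
    rintro p (rfl | ⟨N, hN, A, hA, rfl⟩)
    -- The origin is the vector of minors of the zero system, which is solvable.
    · have h0 : (0 : Fin (k + 1) × Mon k d → AlgebraicClosure K) ∈
          solvableSystems (AlgebraicClosure K) k d :=
        mem_solvableSystems_iff.2 ⟨1, one_ne_zero, fun i => by simp⟩
      rw [← aeval_eq_zero_iff_mem_solvableSystems hspan, aeval_substMinors] at h0
      rw [← pluckerVector_zero k.succ_pos]
      exact h0
    · exact (hv N A hA).2 hN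
  · refine vanishingIdeal_anti_mono ?_
    rintro p (h | ⟨N, -, h⟩)
    · exact Or.inl h
    · exact Or.inr ⟨N, trivial, h⟩

/-- Chow forms of the same variety agree up to units as polynomials in the entries of a matrix. -/
theorem IsChowForm.associated_substMinors {r : ℕ} (hr : 0 < r) {ι : Type*} [Fintype ι]
    [LinearOrder ι] {X : Set (ℙ (AlgebraicClosure K) (ι → AlgebraicClosure K))}
    {F G : MvPolynomial (Fin r ↪o ι) K} (hF : IsChowForm K r X F) (hG : IsChowForm K r X G) :
    Associated (substMinors F) (substMinors G) := by
  have key : ∀ {F G : MvPolynomial (Fin r ↪o ι) K}, IsChowForm K r X F → IsChowForm K r X G →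
      substMinors F ∣ substMinors G := by
    intro F G hF hG
    have : G ∈ Ideal.span {F} ⊔ vanishingIdeal K (pluckerCone (Set.univ :
        Set (Module.Grassmannian (AlgebraicClosure K) (ι → AlgebraicClosure K) r))) := by
      rw [← hF.generates, hG.generates]
      exact Ideal.mem_sup_left (Ideal.mem_span_singleton_self G)
    obtain ⟨a, ha, b, hb, rfl⟩ := Submodule.mem_sup.1 this
    obtain ⟨Q, rfl⟩ := Ideal.mem_span_singleton.1 ha
    -- The summand from the Grassmannian ideal is killed by `substMinors`.
    rw [substMinors_add, substMinors_mul, (vanishingIdeal_pluckerCone_univ hr b).1 hb, add_zero]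
    exact dvd_mul_right _ _
  exact associated_of_dvd_dvd (key hF hG) (key hG hF)

end ChowForm
end Chow

end

theorem mainTheorem2 {K : Type*} [Field K] (k d : ℕ) (hk : 0 < k) (hd : 0 < d) :
    (∃ F : MvPolynomial (Fin (k + 1) ↪o Chow.Mon k d) K,
      Chow.IsChowForm K (k + 1) (Set.range (Chow.veronese (AlgebraicClosure K) k d)) F) ∧
    ∀ F : MvPolynomial (Fin (k + 1) ↪o Chow.Mon k d) K,
      Chow.IsChowForm K (k + 1) (Set.range (Chow.veronese (AlgebraicClosure K) k d)) F →
      ∀ R : MvPolynomial (Fin (k + 1) × Chow.Mon k d) K,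
        Chow.IsResultant K k d R ↔ ∃ c : K, c ≠ 0 ∧ R = c • Chow.substMinors F := by
  obtain ⟨D, F₀, hF₀, hprime, hspan⟩ :=
    Chow.exists_substMinors_span_eq (k := k) K (AlgebraicClosure K) hd
  have hchow := Chow.isChowForm_of_span_eq hF₀ hprime.ne_zero hspan
  refine ⟨⟨F₀, hchow⟩, fun F hF R => ?_⟩
  have hassoc := hchow.associated_substMinors k.succ_pos hF
  rw [Chow.isResultant_iff_associated hprime hspan, ← Chow.associated_iff_exists_smul]
  exact ⟨hassoc.symm.trans, hassoc.trans⟩
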